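/- Let $N\in\mathbb N$, $1<p<N$, $-\infty<\mu<\left(\frac{N-p}{p}\right)^p$, $0\le s<p$, $\lambda\in\mathbb R$, and put $p^*(s)=\frac{(N-s)p}{N-p}$. The equation $\Gamma_\mu(\gamma)=0$, where $\Gamma_\mu(\gamma)=(p-1)|\gamma|^p-(N-p)|\gamma|^{p-2}\gamma+\mu$ for $\gamma\in\mathbb R$, has exactly two real solutions $\gamma_1<\gamma_2$. Let $B\subset\mathbb R^N$ be an open ball of finite radius centered at the origin, and let $u\in W_0^{1,p}(B)$ be positive and radial (almost everywhere in $B$) and a weak solution of $$-\Delta_p u-\frac{\mu}{|x|^p}|u|^{p-2}u=\frac{|u|^{p^*(s)-2}u}{|x|^s}+\lambda|u|^{p-2}u\ \text{ in }B,\qquad u=0\ \text{ on }\partial B,$$ that is, $$\int_B\Big(|\nabla u|^{p-2}\nabla u\cdot\nabla\varphi-\frac{\mu}{|x|^p}|u|^{p-2}u\varphi-\lambda|u|^{p-2}u\varphi\Big)dx=\int_B\frac{|u|^{p^*(s)-2}u}{|x|^s}\varphi\,dx\quad\text{for all }\varphi\in C_0^\infty(B).$$ Then, after modification on a null set, $u$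 is continuously differentiable in $B\setminus\{0\}$ (its classical gradient agreeing almost everywhere with its weak gradient), and there is a constant $C>0$ such that $$\lim_{|x|\to0}u(x)|x|^{\gamma_1}=C\qquad\text{and}\qquad\lim_{|x|\to0}|\nabla u(x)|\,|x|^{\gamma_1+1}=|\gamma_1|\,C.$$ -/

import Mathlib

open MeasureTheory Filter Topology
open scoped ContDiff

namespace HardyBall

/-- `N`-dimensional Euclidean space. -/
abbrev E (N : ℕ) : Type := EuclideanSpace ℝ (Fin N)

/-- The test functions `C₀^∞(Ω)`: smooth functions with compact support contained in `Ω`. -/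
structure IsTest {N : ℕ} (Ω : Set (E N)) (φ : E N → ℝ) : Prop where
  smooth : ContDiff ℝ ∞ φ
  compact : HasCompactSupport φ
  supp : tsupport φ ⊆ Ω

/-- `u ∈ W₀^{1,p}(Ω)` with weak gradient `Du`, for a bounded open set `Ω`: the pair `(u, Du)` is the
limit in `L^p(Ω)` of pairs `(φₙ, ∇φₙ)` with `φₙ ∈ C₀^∞(Ω)`.
Functions are considered up to equality almost everywhere on `Ω`; on a bounded `Ω` this is the
completion of `C₀^∞(Ω)` in `‖∇ ·‖_{L^p}`, because of the Poincaré inequality. -/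
structure MemW01p {N : ℕ} (p : ℝ) (Ω : Set (E N)) (u : E N → ℝ) (Du : E N → E N) : Prop where
  memLp : MemLp u (ENNReal.ofReal p) (volume.restrict Ω)
  memLp_grad : MemLp Du (ENNReal.ofReal p) (volume.restrict Ω)
  approx : ∃ φ : ℕ → E N → ℝ, (∀ n, IsTest Ω (φ n)) ∧
    Tendsto (fun n => eLpNorm (fun x => φ n x - u x) (ENNReal.ofReal p) (volume.restrict Ω))
      atTop (𝓝 0) ∧
    Tendsto (fun n => eLpNorm (fun x => gradient (φ n) x - Du x) (ENNReal.ofReal p)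
      (volume.restrict Ω)) atTop (𝓝 0)

/-- The critical exponent `p*(s) = (N - s) p / (N - p)`. -/
noncomputable def pstar (N : ℕ) (p s : ℝ) : ℝ := ((N : ℝ) - s) * p / ((N : ℝ) - p)

/-- `u` (with weak gradient `Du`) is a weak solution in `W₀^{1,p}(Ω)` of
`-Δ_p u - μ |x|^{-p} |u|^{p-2} u = |x|^{-s} |u|^{p*(s)-2} u + lam |u|^{p-2} u` in `Ω`,
`u = 0` on `∂Ω`. -/
structure IsWeakSolution {N : ℕ} (p μ s lam : ℝ) (Ω : Set (E N))
    (u : E N → ℝ) (Du : E N → E N) : Prop where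
  mem : MemW01p p Ω u Du
  eq : ∀ φ : E N → ℝ, IsTest Ω φ →
    ∫ x in Ω, (‖Du x‖ ^ (p - 2) * inner ℝ (Du x) (gradient φ x)
        - μ / ‖x‖ ^ p * |u x| ^ (p - 2) * u x * φ x
        - lam * |u x| ^ (p - 2) * u x * φ x)
      = ∫ x in Ω, |u x| ^ (pstar N p s - 2) * u x / ‖x‖ ^ s * φ x

/-- `u` is positive almost everywhere on `Ω`. -/
def IsPositiveOn {N : ℕ} (Ω : Set (E N)) (u : E N → ℝ) : Prop :=
  ∀ᵐ x ∂(volume.restrict Ω), 0 < u x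

/-- `u` is radial on `Ω`: almost everywhere it depends only on `‖x‖`. -/
def IsRadialOn {N : ℕ} (Ω : Set (E N)) (u : E N → ℝ) : Prop :=
  ∃ f : ℝ → ℝ, ∀ᵐ x ∂(volume.restrict Ω), u x = f ‖x‖

/-- `Γ_μ(γ) = (p - 1) |γ|^p - (N - p) |γ|^{p-2} γ + μ`. -/
noncomputable def Gam (N : ℕ) (p μ γ : ℝ) : ℝ :=
  (p - 1) * |γ| ^ p - ((N : ℝ) - p) * |γ| ^ (p - 2) * γ + μ

end HardyBall

/-! The statement is about one scalar ODE. A radial element of W₀^{1,p} has a radial weak gradient,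
and the du Bois-Reymond lemma, applied to the profile U and then to the flux r^(N-1) |U'|^(p-2) U',
shows that U is C¹ and solves the radial equation on (0, R)
(`IsWeakSolution.exists_isRadialSolution`). A strong maximum principle gives U > 0 at every radius
(`IsRadialSolution.pos`), and finite energy gives r^δ U → 0 with δ = (N-p)/p
(`IsRadialSolution.tendsto_rpow_mul`).

Put τ = -log r, y = log U and ζ = |y'|^(p-2) y', derivatives being in τ. Then ζ' = -(H(ζ) + G),
where H(Z) = (p-1)|Z|^q - (N-p) Z + μ with q conjugate to p, and G = exp(b (y - δτ)) + λ exp(-pτ)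
with b = p*(s) - p. The substitution Z = |γ|^(p-2) γ turns Γ_μ into H. H decreases up to Z =
δ^(p-1), increases afterwards, and its minimum μ - δ^p is negative, so there are exactly two zeros
Z₁ < Z₂, which correspond to γ₁ < γ₂. The decay r^δ U → 0 says y - δτ → -∞, hence G → 0.

For ζ' = -H(ζ) the point Z₁ repels and Z₂ attracts. If ζ were ever well below Z₁ at a late time, it
would reach -∞ in finite time. If it were well above Z₁, it would move past δ^(p-1) and stay there,
so that y' > δ and y - δτ would not decrease, against y - δτ → -∞. Hence ζ → Z₁ (`riccati_tendsto`).
A solution that converges to a repelling point is no further from it than a multiple of the forcing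
(`le_exp_of_unstable`), and G decays exponentially once y' stays below δ. So y' - γ₁ is integrable,
y - γ₁τ has a limit L, and C = exp L (`emdenFowler_asymptotics`). The gradient limit follows from -r
U'/U = y' → γ₁. -/

namespace HardyBall

/-! ### Odd powers -/

/-- The odd power `|x|^(a-2) x`. -/
noncomputable def oddPow (a x : ℝ) : ℝ := |x| ^ (a - 2) * x

theorem abs_oddPow {a : ℝ} (ha : 1 < a) (x : ℝ) : |oddPow a x| = |x| ^ (a - 1) := by
  unfold oddPow
  rcases eq_or_ne x 0 with rfl | hx
  · simp [Real.zero_rpow (by linarith : a - 1 ≠ 0)]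
  · have : 0 < |x| := abs_pos.2 hx
    rw [abs_mul, abs_of_nonneg (by positivity), show a - 1 = (a - 2) + 1 by ring,
      Real.rpow_add_one this.ne']

theorem oddPow_of_nonneg {a : ℝ} (ha : 1 < a) {x : ℝ} (hx : 0 ≤ x) :
    oddPow a x = x ^ (a - 1) := by
  have := abs_oddPow ha x
  rwa [abs_of_nonneg hx, abs_of_nonneg] at this
  unfold oddPow; positivity

theorem oddPow_neg (a x : ℝ) : oddPow a (-x) = -oddPow a x := by
  simp [oddPow]

@[simp] theorem oddPow_zero (a : ℝ) : oddPow a 0 = 0 := by simp [oddPow]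

theorem oddPow_pos {a x : ℝ} (hx : 0 < x) : 0 < oddPow a x := by
  unfold oddPow; positivity

theorem oddPow_strictMono {a : ℝ} (ha : 1 < a) : StrictMono (oddPow a) := by
  have h1 : StrictMonoOn (oddPow a) (Set.Ici 0) := by
    intro x hx y hy hxy
    rw [oddPow_of_nonneg ha hx, oddPow_of_nonneg ha hy]
    exact Real.rpow_lt_rpow hx hxy (by linarith)
  intro x y hxy
  rcases le_or_gt 0 x with hx | hx
  · exact h1 hx (hx.trans hxy.le) hxy
  · rcases le_or_gt 0 y with hy | hy
    · have h2 : oddPow a x < 0 := by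
        have := oddPow_pos (a := a) (neg_pos.2 hx)
        rw [oddPow_neg] at this; linarith
      have h3 : 0 ≤ oddPow a y := by unfold oddPow; positivity
      linarith
    · have := h1 (a := -y) (b := -x) (by simp; linarith) (by simp; linarith) (by linarith)
      rw [oddPow_neg, oddPow_neg] at this; linarith

theorem hasDerivAt_abs_rpow_oddPow {a : ℝ} (ha : 1 < a) (x : ℝ) :
    HasDerivAt (fun x => |x| ^ a) (a * oddPow a x) x := by
  have := hasDerivAt_abs_rpow x ha
  unfold oddPow
  rwa [← mul_assoc]

/-- Conjugacy means (p - 1)(q - 1) = 1, so the two odd powers are mutually inverse. This recovers a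
slope from its flux and translates between γ and Z. -/
theorem oddPow_conj {p q : ℝ} (h : p.HolderConjugate q) (x : ℝ) :
    oddPow q (oddPow p x) = x := by
  have key : ∀ x : ℝ, 0 ≤ x → oddPow q (oddPow p x) = x := by
    intro x hx
    rw [oddPow_of_nonneg h.lt hx, oddPow_of_nonneg h.symm.lt (by positivity), ← Real.rpow_mul hx,
      show (p - 1) * (q - 1) = 1 by have := h.mul_eq_add; linarith, Real.rpow_one]
  rcases le_total 0 x with hx | hx
  · exact key x hx
  · have := key (-x) (by linarith)
    rw [oddPow_neg, oddPow_neg] at this; linarith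

theorem hasDerivAt_oddPow {a x : ℝ} (hx : x ≠ 0) :
    HasDerivAt (oddPow a) ((a - 1) * |x| ^ (a - 2)) x := by
  have key : ∀ x : ℝ, 0 < x → HasDerivAt (oddPow a) ((a - 1) * |x| ^ (a - 2)) x := by
    intro x hx
    have h1 := (Real.hasDerivAt_rpow_const (x := x) (p := a - 1) (Or.inl hx.ne'))
    rw [abs_of_pos hx]
    rw [show a - 1 - 1 = a - 2 by ring] at h1
    refine h1.congr_of_eventuallyEq ?_
    filter_upwards [lt_mem_nhds hx] with y hy
    rw [oddPow, abs_of_pos hy, show a - 1 = (a - 2) + 1 by ring, Real.rpow_add_one hy.ne']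
  rcases lt_or_gt_of_ne hx with hx | hx
  · have h1 := key (-x) (by linarith)
    have h2 := (h1.comp x (hasDerivAt_neg x)).neg
    have h3 : oddPow a = -oddPow a ∘ Neg.neg := by funext y; simp [oddPow_neg]
    rw [h3]
    exact h2.congr_deriv (by rw [abs_neg]; ring)
  · exact key x hx

theorem continuous_oddPow {a : ℝ} (ha : 1 < a) : Continuous (oddPow a) := by
  rw [continuous_iff_continuousAt]
  intro x
  rcases eq_or_ne x 0 with rfl | hx
  · rw [ContinuousAt, oddPow_zero, tendsto_zero_iff_abs_tendsto_zero]
    have h : Tendsto (fun x : ℝ => |x| ^ (a - 1)) (𝓝 0) (𝓝 (|0| ^ (a - 1))) :=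
      (continuous_abs.rpow_const (fun x => Or.inr (by linarith))).tendsto 0
    rw [abs_zero, Real.zero_rpow (by linarith)] at h
    exact h.congr (fun x => (abs_oddPow ha x).symm)
  · exact (hasDerivAt_oddPow hx).continuousAt

/-! ### Comparison principles for scalar differential equations -/

/-- A barrier argument: to go below the level c, the function would have to leave it downwards, and
its slope is positive whenever it is there. -/
theorem le_of_hasDerivAt_pos_at_level {f f' : ℝ → ℝ} {a c : ℝ}
    (hf : ∀ t, a ≤ t → HasDerivAt f (f' t) t) (ha : c ≤ f a)
    (hc : ∀ t, a ≤ t → f t = c → 0 < f' t) : ∀ t, a ≤ t → c ≤ f t := by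
  intro b hb
  have h := image_le_of_deriv_right_lt_deriv_boundary (f := fun t => -f t) (f' := fun t => -f' t)
    (a := a) (b := b) (B := fun _ => -c) (B' := fun _ => 0)
    (fun t ht => (hf t ht.1).continuousAt.neg.continuousWithinAt)
    (fun t ht => (hf t ht.1).neg.hasDerivWithinAt) (by simpa using ha)
    (fun t => hasDerivAt_const _ _)
    (fun t ht h => by
      have := hc t ht.1 (neg_injective h); simpa using this)
  simpa using h ⟨hb, le_rfl⟩

theorem add_mul_le_of_hasDerivAt_ge {f f' : ℝ → ℝ} {a c : ℝ}
    (hf : ∀ t, a ≤ t → HasDerivAt f (f' t) t) (hc : ∀ t, a ≤ t → c ≤ f' t) :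
    ∀ t, a ≤ t → f a + c * (t - a) ≤ f t := by
  have hm : MonotoneOn (fun t => f t - c * t) (Set.Ici a) := by
    refine monotoneOn_of_hasDerivWithinAt_nonneg (f' := fun t => f' t - c) (convex_Ici a) ?_ ?_ ?_
    · exact fun t ht => ((hf t ht).continuousAt.sub (by fun_prop)).continuousWithinAt
    · intro t ht
      rw [interior_Ici] at ht
      have h1 := ((hf t (le_of_lt ht)).sub ((hasDerivAt_id t).const_mul c)).hasDerivWithinAt
        (s := interior (Set.Ici a))
      rw [mul_one, interior_Ici] at h1
      rw [interior_Ici]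
      exact h1
    · intro t ht
      rw [interior_Ici] at ht
      have := hc t (le_of_lt ht)
      linarith
  intro t ht
  have := hm (Set.mem_Ici.2 le_rfl) (Set.mem_Ici.2 ht) ht
  simp only at this
  linarith

theorem tendsto_atTop_of_hasDerivAt_ge {f f' : ℝ → ℝ} {a c : ℝ} (hc0 : 0 < c)
    (hf : ∀ t, a ≤ t → HasDerivAt f (f' t) t) (hc : ∀ t, a ≤ t → c ≤ f' t) :
    Tendsto f atTop atTop := by
  refine tendsto_atTop_mono' _ (f₁ := fun t => f a + c * (t - a)) ?_ ?_
  · filter_upwards [eventually_ge_atTop a] with t ht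
    exact add_mul_le_of_hasDerivAt_ge hf hc t ht
  · refine tendsto_atTop_add_const_left _ _ (Tendsto.const_mul_atTop hc0 ?_)
    exact tendsto_atTop_add_const_right _ _ tendsto_id

/-- A global solution of `f' ≥ c f ^ q` with `q > 1` cannot be positive. -/
theorem false_of_hasDerivAt_ge_rpow {f f' : ℝ → ℝ} {a c q : ℝ} (hq : 1 < q) (hc0 : 0 < c)
    (hf : ∀ t, a ≤ t → HasDerivAt f (f' t) t) (hpos : ∀ t, a ≤ t → 0 < f t)
    (hc : ∀ t, a ≤ t → c * f t ^ q ≤ f' t) : False := by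
  -- The power f^(1-q) linearises the inequality: -(f^(1-q)) has slope at least c (q - 1), so it
  -- would tend to infinity, although it is negative.
  have h1 : ∀ t, a ≤ t → HasDerivAt (fun t => -(f t ^ (1 - q)))
      (-(f' t * (1 - q) * f t ^ (1 - q - 1))) t :=
    fun t ht => ((hf t ht).rpow_const (Or.inl (hpos t ht).ne')).neg
  have h2 : Tendsto (fun t => -(f t ^ (1 - q))) atTop atTop := by
    refine tendsto_atTop_of_hasDerivAt_ge (c := c * (q - 1)) (by nlinarith) h1 fun t ht => ?_
    have h3 := hpos t ht
    have h4 : f t ^ q * f t ^ (1 - q - 1) = 1 := by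
      rw [← Real.rpow_add h3, show q + (1 - q - 1) = 0 by ring, Real.rpow_zero]
    have h5 : 0 < f t ^ (1 - q - 1) := by positivity
    have h6 := mul_le_mul_of_nonneg_right (hc t ht) (mul_nonneg h5.le (by linarith : 0 ≤ q - 1))
    have h7 : c * f t ^ q * (f t ^ (1 - q - 1) * (q - 1)) = c * (q - 1) := by
      linear_combination c * (q - 1) * h4
    rw [h7] at h6
    linarith
  obtain ⟨t, ht, ht'⟩ := ((h2.eventually (eventually_gt_atTop 0)).and
    (eventually_ge_atTop a)).exists
  have := Real.rpow_pos_of_pos (hpos t ht') (1 - q)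
  linarith

/-! ### The Hamiltonian and its zeros -/

/-- The Hamiltonian `(p-1) |Z|^q - (n-p) Z + μ` of the Riccati equation. -/
noncomputable def Ham (p q n μ Z : ℝ) : ℝ := (p - 1) * |Z| ^ q - (n - p) * Z + μ

section Ham
variable {p q n μ : ℝ}

theorem hasDerivAt_Ham (h : p.HolderConjugate q) (Z : ℝ) :
    HasDerivAt (Ham p q n μ) (p * oddPow q Z - (n - p)) Z := by
  have h1 := (((hasDerivAt_abs_rpow_oddPow h.symm.lt Z).const_mul (p - 1)).sub
    ((hasDerivAt_id Z).const_mul (n - p))).add_const μ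
  have h2 : (p - 1) * q = p := by have := h.mul_eq_add; linarith
  refine h1.congr_deriv ?_
  rw [← mul_assoc, h2, mul_one]

theorem continuous_Ham (h : p.HolderConjugate q) : Continuous (Ham p q n μ) :=
  continuous_iff_continuousAt.2 fun Z => (hasDerivAt_Ham h Z).continuousAt

/-- The right side is Γ_μ(γ): zeros of Γ_μ and zeros of the Hamiltonian correspond under the odd
power. -/
theorem Ham_oddPow (h : p.HolderConjugate q) (γ : ℝ) :
    Ham p q n μ (oddPow p γ) = (p - 1) * |γ| ^ p - (n - p) * oddPow p γ + μ := by
  rw [Ham, abs_oddPow h.lt, ← Real.rpow_mul (abs_nonneg _),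
    show (p - 1) * q = p by have := h.mul_eq_add; linarith]

theorem oddPow_lt_iff (h : p.HolderConjugate q) {Z x : ℝ} :
    oddPow q Z < x ↔ Z < oddPow p x := by
  rw [← (oddPow_strictMono h.lt).lt_iff_lt, oddPow_conj h.symm]

theorem lt_oddPow_iff (h : p.HolderConjugate q) {Z x : ℝ} :
    x < oddPow q Z ↔ oddPow p x < Z := by
  rw [← (oddPow_strictMono h.lt).lt_iff_lt, oddPow_conj h.symm]

/-- The derivative is p (|Z|^(q-2) Z - δ) with δ = (n-p)/p, negative exactly to the left of the
vertex |δ|^(p-2) δ. -/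
theorem Ham_strictAntiOn (h : p.HolderConjugate q) :
    StrictAntiOn (Ham p q n μ) (Set.Iic (oddPow p ((n - p) / p))) := by
  refine strictAntiOn_of_deriv_neg (convex_Iic _) (continuous_Ham h).continuousOn fun Z hZ => ?_
  rw [interior_Iic, Set.mem_Iio, ← oddPow_lt_iff h, lt_div_iff₀ h.pos] at hZ
  rw [(hasDerivAt_Ham h Z).deriv]
  linarith

theorem Ham_strictMonoOn (h : p.HolderConjugate q) :
    StrictMonoOn (Ham p q n μ) (Set.Ici (oddPow p ((n - p) / p))) := by
  refine strictMonoOn_of_deriv_pos (convex_Ici _) (continuous_Ham h).continuousOn fun Z hZ => ?_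
  rw [interior_Ici, Set.mem_Ioi, ← lt_oddPow_iff h, div_lt_iff₀ h.pos] at hZ
  rw [(hasDerivAt_Ham h Z).deriv]
  linarith

/-- The value at the vertex is (p-1) δ^p - p δ^p + μ = μ - δ^p, so the bound on μ says precisely
that the minimum is negative. -/
theorem Ham_vertex_neg (h : p.HolderConjugate q) (hpn : p < n) (hμ : μ < ((n - p) / p) ^ p) :
    Ham p q n μ (oddPow p ((n - p) / p)) < 0 := by
  have hδ : 0 < (n - p) / p := div_pos (by linarith) h.pos
  rw [Ham_oddPow h, abs_of_pos hδ, oddPow_of_nonneg h.lt hδ.le]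
  have h1 : ((n - p) / p) ^ p = ((n - p) / p) ^ (p - 1) * ((n - p) / p) := by
    rw [← Real.rpow_add_one hδ.ne']; ring_nf
  have h2 : (n - p) * ((n - p) / p) ^ (p - 1) = p * ((n - p) / p) ^ p := by
    have := h.pos.ne'
    rw [h1]; field_simp
  rw [h2]; linarith

/-- The term |Z|^q dominates because q > 1. The quantitative bound at -x drives the finite-time
blow-up of the Riccati equation; both bounds serve to bracket the zeros. -/
theorem exists_Ham_pos_of_lt (h : p.HolderConjugate q) (hpn : p < n) :
    ∃ A : ℝ, 0 < A ∧ ∀ x, A ≤ x → x ^ q * ((p - 1) / 2) ≤ Ham p q n μ (-x) ∧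
      0 < Ham p q n μ x := by
  have hp := h.lt
  have hq := h.symm.lt
  have h1 : Tendsto (fun x : ℝ => x ^ (q - 1)) atTop atTop := tendsto_rpow_atTop (by linarith)
  have h2 : Tendsto (fun x : ℝ => x ^ q) atTop atTop := tendsto_rpow_atTop (by linarith)
  -- The first threshold lets half of (p-1) x^q absorb the linear term, the second lets the other
  -- half absorb |μ|.
  obtain ⟨A, hA⟩ := eventually_atTop.1
    (((h1.eventually (eventually_ge_atTop (2 * (n - p) / (p - 1)))).and
    (h2.eventually (eventually_ge_atTop ((2 * |μ| + 1) / (p - 1))))).and (eventually_gt_atTop 0))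
  refine ⟨max A 1, by positivity, fun x hx => ?_⟩
  obtain ⟨⟨h3, h4⟩, h5⟩ := hA x (le_trans (le_max_left _ _) hx)
  rw [div_le_iff₀ (by linarith)] at h3 h4
  have h6 : x ^ q = x ^ (q - 1) * x := by rw [← Real.rpow_add_one h5.ne']; ring_nf
  have h7 := neg_abs_le μ
  have h8 := mul_le_mul_of_nonneg_right h3 h5.le
  have h9 : x ^ (q - 1) * (p - 1) * x = x ^ q * (p - 1) := by rw [h6]; ring
  have h10 : 0 ≤ (n - p) * x := mul_nonneg (by linarith) h5.le
  rw [h9] at h8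
  simp only [Ham, abs_neg, abs_of_pos h5]
  constructor <;> nlinarith

/-- The two zeros of the Hamiltonian. -/
theorem exists_Ham_zeros (h : p.HolderConjugate q) (hpn : p < n) (hμ : μ < ((n - p) / p) ^ p) :
    ∃ Z₁ Z₂ : ℝ, Z₁ < oddPow p ((n - p) / p) ∧ oddPow p ((n - p) / p) < Z₂ ∧
      Ham p q n μ Z₁ = 0 ∧ Ham p q n μ Z₂ = 0 := by
  obtain ⟨A, hA, hA'⟩ := exists_Ham_pos_of_lt (μ := μ) h hpn
  have hv := Ham_vertex_neg h hpn hμ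
  set V := oddPow p ((n - p) / p)
  have hp := h.lt
  have hc : Continuous (Ham p q n μ) := continuous_Ham h
  have hm := hA' (max A |V|) (le_max_left _ _)
  have hpos : 0 < max A |V| := lt_of_lt_of_le hA (le_max_left _ _)
  have hm1 : 0 < Ham p q n μ (-max A |V|) := lt_of_lt_of_le (by
    have := Real.rpow_pos_of_pos hpos q
    have : 0 < (p - 1) / 2 := by linarith
    positivity) hm.1
  have hV := le_max_right A |V|
  obtain ⟨Z₁, hZ₁, hZ₁'⟩ := intermediate_value_Icc' (f := Ham p q n μ) (a := -max A |V|) (b := V)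
    (by linarith [neg_abs_le V]) hc.continuousOn ⟨hv.le, hm1.le⟩
  obtain ⟨Z₂, hZ₂, hZ₂'⟩ := intermediate_value_Icc (f := Ham p q n μ) (b := max A |V|) (a := V)
    (by linarith [le_abs_self V]) hc.continuousOn ⟨hv.le, hm.2.le⟩
  refine ⟨Z₁, Z₂, lt_of_le_of_ne hZ₁.2 ?_, lt_of_le_of_ne hZ₂.1 ?_, hZ₁', hZ₂'⟩
  · rintro rfl; linarith
  · intro h'; rw [← h'] at hZ₂'; linarith

end Ham

/-! ### The perturbed Riccati equation in logarithmic time -/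

section Riccati
variable {p q n μ Z₁ Z₂ T : ℝ} {ζ y G : ℝ → ℝ}

/-- Below Z₁ - ε the Hamiltonian is at least 2η, and late enough |G| no longer matters, so a
solution found there keeps decreasing to -∞. There the superlinear term forces blow-up in finite
time, while ζ exists for all large τ. -/
theorem riccati_eventually_ge (h : p.HolderConjugate q) (hpn : p < n)
    (hZ₁ : Z₁ < oddPow p ((n - p) / p)) (hH : Ham p q n μ Z₁ = 0)
    (hζ : ∀ τ, T ≤ τ → HasDerivAt ζ (-(Ham p q n μ (ζ τ) + G τ)) τ)
    (hG : Tendsto G atTop (𝓝 0)) {ε : ℝ} (hε : 0 < ε) : ∀ᶠ τ in atTop, Z₁ - ε ≤ ζ τ := by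
  have hp := h.lt
  set η := Ham p q n μ (Z₁ - ε) / 2 with hη
  have hηpos : 0 < η := by
    have := Ham_strictAntiOn (μ := μ) h (a := Z₁ - ε) (b := Z₁) (Set.mem_Iic.2 (by linarith))
      (Set.mem_Iic.2 hZ₁.le) (by linarith)
    linarith
  filter_upwards [(eventually_ge_atTop T).and
    (eventually_forall_ge_atTop.2 (hG.eventually (lt_mem_nhds (neg_lt_zero.2 hηpos))))]
    with τ₀ ⟨hT, hG'⟩
  by_contra! hlt
  have hd : ∀ t, τ₀ ≤ t → HasDerivAt (fun t => -ζ t) (Ham p q n μ (ζ t) + G t) t := fun t ht =>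
    (hζ t (hT.trans ht)).neg.congr_deriv (neg_neg _)
  have hb : ∀ t, τ₀ ≤ t → -(Z₁ - ε) ≤ -ζ t :=
    le_of_hasDerivAt_pos_at_level hd (by linarith) fun t ht hlev => by
      have := hG' t ht
      rw [neg_injective hlev]; linarith
  have hHge : ∀ t, τ₀ ≤ t → 2 * η ≤ Ham p q n μ (ζ t) := fun t ht => by
    have := (Ham_strictAntiOn (μ := μ) h).antitoneOn (a := ζ t) (b := Z₁ - ε)
      (Set.mem_Iic.2 (by linarith [hb t ht])) (Set.mem_Iic.2 (by linarith)) (by linarith [hb t ht])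
    linarith
  have hinf : Tendsto (fun t => -ζ t) atTop atTop :=
    tendsto_atTop_of_hasDerivAt_ge hηpos hd fun t ht => by linarith [hHge t ht, hG' t ht]
  obtain ⟨A, hA, hA'⟩ := exists_Ham_pos_of_lt (μ := μ) h hpn
  obtain ⟨τ₁, hτ₁⟩ := eventually_atTop.1 (hinf.eventually (eventually_ge_atTop A))
  have hτ : ∀ t, max τ₀ τ₁ ≤ t → A ≤ -ζ t := fun t ht => hτ₁ t ((le_max_right _ _).trans ht)
  -- The constant comes from averaging the two bounds H ≥ (p-1)/2 · (-ζ)^q and H ≥ 2η; the term η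
  -- that this leaves absorbs G > -η.
  refine false_of_hasDerivAt_ge_rpow (a := max τ₀ τ₁) (c := (p - 1) / 4) h.symm.lt (by linarith)
    (fun t ht => hd t ((le_max_left _ _).trans ht)) (fun t ht => hA.trans_le (hτ t ht)) ?_
  intro t ht
  have h1 := (hA' _ (hτ t ht)).1
  rw [neg_neg] at h1
  have h2 := hHge t ((le_max_left _ _).trans ht)
  have h3 := hG' t ((le_max_left _ _).trans ht)
  linarith

/-- Between Z₁ and Z₂ the Hamiltonian is negative and pushes ζ up. A solution above Z₁ + ε is
therefore carried beyond the vertex and trapped there, where y' > δ, which is incompatible with y -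
δτ → -∞. -/
theorem riccati_eventually_le (h : p.HolderConjugate q)
    (hZ₁ : Z₁ < oddPow p ((n - p) / p)) (hZ₂ : oddPow p ((n - p) / p) < Z₂)
    (hH₁ : Ham p q n μ Z₁ = 0) (hH₂ : Ham p q n μ Z₂ = 0)
    (hζ : ∀ τ, T ≤ τ → HasDerivAt ζ (-(Ham p q n μ (ζ τ) + G τ)) τ)
    (hG : Tendsto G atTop (𝓝 0))
    (hy : ∀ τ, T ≤ τ → HasDerivAt y (oddPow q (ζ τ)) τ)
    (hyb : Tendsto (fun τ => y τ - (n - p) / p * τ) atTop atBot)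
    {ε : ℝ} (hε : 0 < ε) (hεV : Z₁ + ε < oddPow p ((n - p) / p)) :
    ∀ᶠ τ in atTop, ζ τ ≤ Z₁ + ε := by
  set δ := (n - p) / p
  set V := oddPow p δ
  -- A level strictly between the vertex and Z₂: the Hamiltonian is still negative at Z', and ζ ≥ Z'
  -- implies y' > δ. On [Z₁ + ε, Z'] the larger endpoint value bounds the Hamiltonian, since it
  -- first decreases and then increases.
  set Z' := (V + Z₂) / 2 with hZ'
  set η := -(max (Ham p q n μ (Z₁ + ε)) (Ham p q n μ Z')) / 2 with hη
  have hηpos : 0 < η := by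
    have h1 := Ham_strictAntiOn (μ := μ) h (a := Z₁) (b := Z₁ + ε) (Set.mem_Iic.2 hZ₁.le)
      (Set.mem_Iic.2 hεV.le) (by linarith)
    have h2 := Ham_strictMonoOn (μ := μ) h (a := Z') (b := Z₂)
      (Set.mem_Ici.2 (show V ≤ Z' by linarith)) (Set.mem_Ici.2 hZ₂.le) (by linarith)
    have := max_lt (h1.trans_eq hH₁) (h2.trans_eq hH₂)
    linarith
  have hHle : ∀ Z, Z₁ + ε ≤ Z → Z ≤ Z' → Ham p q n μ Z ≤ -(2 * η) := by
    intro Z hZ hZ2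
    have e : -(2 * η) = max (Ham p q n μ (Z₁ + ε)) (Ham p q n μ Z') := by rw [hη]; ring
    rw [e]
    rcases le_total Z V with hV | hV
    · exact le_max_of_le_left ((Ham_strictAntiOn (μ := μ) h).antitoneOn (Set.mem_Iic.2 hεV.le)
        (Set.mem_Iic.2 hV) hZ)
    · exact le_max_of_le_right ((Ham_strictMonoOn (μ := μ) h).monotoneOn (Set.mem_Ici.2 hV)
        (Set.mem_Ici.2 (show V ≤ Z' by linarith)) hZ2)
  filter_upwards [(eventually_ge_atTop T).and
    (eventually_forall_ge_atTop.2 (hG.eventually (gt_mem_nhds hηpos)))] with τ₀ ⟨hT, hG'⟩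
  by_contra! hlt
  have hd : ∀ t, τ₀ ≤ t → HasDerivAt ζ (-(Ham p q n μ (ζ t) + G t)) t :=
    fun t ht => hζ t (hT.trans ht)
  have hb : ∀ t, τ₀ ≤ t → Z₁ + ε ≤ ζ t :=
    le_of_hasDerivAt_pos_at_level hd hlt.le fun t ht hlev => by
      have h1 := hG' t ht
      have h2 := hHle (ζ t) hlev.ge (by linarith)
      linarith
  -- As long as ζ stays in [Z₁ + ε, Z') its slope is at least η, so it cannot stay there forever.
  obtain ⟨τ₁, h01, hτ₁⟩ : ∃ τ₁, τ₀ ≤ τ₁ ∧ Z' ≤ ζ τ₁ := by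
    by_contra! hcon
    have := tendsto_atTop_of_hasDerivAt_ge hηpos hd fun t ht => by
      linarith [hG' t ht, hHle (ζ t) (hb t ht) (hcon t ht).le]
    obtain ⟨t, ht, ht'⟩ := ((this.eventually (eventually_ge_atTop Z')).and
      (eventually_ge_atTop τ₀)).exists
    linarith [hcon t ht']
  have hb' : ∀ t, τ₁ ≤ t → Z' ≤ ζ t :=
    le_of_hasDerivAt_pos_at_level (fun t ht => hd t (h01.trans ht)) hτ₁ fun t ht hlev => by
      have h1 := hG' t (h01.trans ht)
      have h2 := hHle (ζ t) (by linarith) hlev.le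
      linarith
  -- From τ₁ on, y - δτ is nondecreasing.
  have hm := add_mul_le_of_hasDerivAt_ge (f := fun t => y t - δ * t) (a := τ₁) (c := 0)
    (fun t ht => ((hy t (hT.trans (h01.trans ht))).sub ((hasDerivAt_id t).const_mul δ)))
    (fun t ht => by
      have : δ < oddPow q (ζ t) := (lt_oddPow_iff h).2 (by
        show V < ζ t
        linarith [hb' t ht])
      simpa using this.le)
  obtain ⟨t, ht, ht'⟩ := ((hyb.eventually (eventually_lt_atBot (y τ₁ - δ * τ₁))).and
    (eventually_ge_atTop τ₁)).exists
  have := hm t ht'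
  linarith

theorem riccati_tendsto (h : p.HolderConjugate q) (hpn : p < n)
    (hZ₁ : Z₁ < oddPow p ((n - p) / p)) (hZ₂ : oddPow p ((n - p) / p) < Z₂)
    (hH₁ : Ham p q n μ Z₁ = 0) (hH₂ : Ham p q n μ Z₂ = 0)
    (hζ : ∀ τ, T ≤ τ → HasDerivAt ζ (-(Ham p q n μ (ζ τ) + G τ)) τ)
    (hG : Tendsto G atTop (𝓝 0))
    (hy : ∀ τ, T ≤ τ → HasDerivAt y (oddPow q (ζ τ)) τ)
    (hyb : Tendsto (fun τ => y τ - (n - p) / p * τ) atTop atBot) :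
    Tendsto ζ atTop (𝓝 Z₁) := by
  rw [Metric.tendsto_nhds]
  intro ε hε
  set ε' := min (ε / 2) ((oddPow p ((n - p) / p) - Z₁) / 2)
  have h0 : 0 < ε' := lt_min (by linarith) (by linarith)
  have h1 : ε' ≤ ε / 2 := min_le_left _ _
  have h2 : ε' ≤ (oddPow p ((n - p) / p) - Z₁) / 2 := min_le_right _ _
  filter_upwards [riccati_eventually_ge h hpn hZ₁ hH₁ hζ hG h0,
    riccati_eventually_le h hZ₁ hZ₂ hH₁ hH₂ hζ hG hy hyb h0 (by linarith)] with τ h3 h4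
  rw [Real.dist_eq, abs_lt]
  constructor <;> linarith

/-- A solution of `W' ≥ k W - C e^{-aτ}` tending to zero decays like `e^{-aτ}`. -/
theorem le_exp_of_unstable {W W' : ℝ → ℝ} {k C a : ℝ} (hk : 0 < k) (hC : 0 ≤ C) (ha : 0 < a)
    (hW : ∀ t, T ≤ t → HasDerivAt W (W' t) t) (h0 : Tendsto W atTop (𝓝 0))
    (hge : ∀ t, T ≤ t → 0 < W t → k * W t - C * Real.exp (-a * t) ≤ W' t) :
    ∀ t, T ≤ t → W t ≤ C / k * Real.exp (-a * t) := by
  intro τ₀ hτ₀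
  by_contra! hlt
  -- With kA = C, the profile A exp(-at) cancels the forcing term: the excess X of W over it, once
  -- positive, cannot fall below its initial value, contradicting W → 0.
  set A := C / k
  have hA : 0 ≤ A := by positivity
  have hkA : k * A = C := by simp only [A]; field_simp
  set X : ℝ → ℝ := fun t => W t - A * Real.exp (-a * t)
  have hX0 : 0 < X τ₀ := sub_pos.2 hlt
  have hdX : ∀ t, τ₀ ≤ t → HasDerivAt X (W' t + A * a * Real.exp (-a * t)) t := fun t ht => by
    have h1 : HasDerivAt (fun t => Real.exp (-a * t)) (Real.exp (-a * t) * (-a)) t := by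
      simpa using ((hasDerivAt_id t).const_mul (-a)).exp
    exact ((hW t (hτ₀.trans ht)).sub (h1.const_mul A)).congr_deriv (by ring)
  have hb := le_of_hasDerivAt_pos_at_level hdX le_rfl fun t ht hlev => by
    have he := Real.exp_pos (-a * t)
    have hWt : W t = X τ₀ + A * Real.exp (-a * t) := by rw [← hlev]; simp [X]
    have h1 := hge t (hτ₀.trans ht) (by rw [hWt]; positivity)
    have h2 : k * W t = k * X τ₀ + C * Real.exp (-a * t) := by rw [hWt, ← hkA]; ring
    have h3 : 0 ≤ A * a * Real.exp (-a * t) := by positivity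
    have h4 : 0 < k * X τ₀ := by positivity
    linarith
  obtain ⟨t, ht, ht'⟩ := ((h0.eventually (gt_mem_nhds hX0)).and (eventually_ge_atTop τ₀)).exists
  have h1 := hb t ht'
  have h2 : 0 ≤ A * Real.exp (-a * t) := by positivity
  simp only [X] at h1 ht
  linarith

/-- Near Z₁ the deviation ζ - Z₁ satisfies a linear equation with positive rate, forced by G.
Applying `le_exp_of_unstable` to the deviation and to its negative gives it the decay rate of G. -/
theorem riccati_rate (h : p.HolderConjugate q)
    (hZ₁ : Z₁ < oddPow p ((n - p) / p)) (hH₁ : Ham p q n μ Z₁ = 0)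
    (hζ : ∀ τ, T ≤ τ → HasDerivAt ζ (-(Ham p q n μ (ζ τ) + G τ)) τ)
    (hlim : Tendsto ζ atTop (𝓝 Z₁)) {C a : ℝ} (hC : 0 ≤ C) (ha : 0 < a)
    (hG : ∀ᶠ τ in atTop, |G τ| ≤ C * Real.exp (-a * τ)) :
    ∃ A, 0 ≤ A ∧ ∀ᶠ τ in atTop, |ζ τ - Z₁| ≤ A * Real.exp (-a * τ) := by
  -- Half of -H'(Z₁), which is positive left of the vertex. The other half is given up to the
  -- remainder of the linearisation.
  set k := ((n - p) - p * oddPow q Z₁) / 2 with hk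
  have hkpos : 0 < k := by
    rw [← oddPow_lt_iff h, lt_div_iff₀ h.pos] at hZ₁
    linarith
  have hlin := ((hasDerivAt_Ham (n := n) (μ := μ) h Z₁).isLittleO.def hkpos)
  have hW0 : Tendsto (fun t => ζ t - Z₁) atTop (𝓝 0) := by
    simpa using hlim.sub_const Z₁
  obtain ⟨T', hT'⟩ := eventually_atTop.1 (((hlim.eventually hlin).and hG).and
    (eventually_ge_atTop T))
  have hW : ∀ t, T' ≤ t → HasDerivAt (fun t => ζ t - Z₁) (-(Ham p q n μ (ζ t) + G t)) t :=
    fun t ht => (hζ t (hT' t ht).2).sub_const _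
  have hest : ∀ t, T' ≤ t → |Ham p q n μ (ζ t) + 2 * k * (ζ t - Z₁)| ≤ k * |ζ t - Z₁| := by
    intro t ht
    have := (hT' t ht).1.1
    simp only [hH₁, Real.norm_eq_abs, smul_eq_mul] at this
    convert this using 2
    rw [hk]; ring
  refine ⟨C / k, by positivity, ?_⟩
  filter_upwards [eventually_ge_atTop T'] with t ht
  rw [abs_le]
  constructor
  · have := le_exp_of_unstable (W := fun t => -(ζ t - Z₁)) hkpos hC ha
      (fun t ht => (hW t ht).neg) (by simpa using hW0.neg) (fun t ht hpos => by
        have h1 := hest t ht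
        have h2 := abs_le.1 (hT' t ht).1.2
        rw [abs_of_neg (by linarith : ζ t - Z₁ < 0)] at h1
        have h3 := abs_le.1 h1
        linarith) t ht
    linarith
  · exact le_exp_of_unstable (W := fun t => ζ t - Z₁) hkpos hC ha hW hW0 (fun t ht hpos => by
        have h1 := hest t ht
        have h2 := abs_le.1 (hT' t ht).1.2
        rw [abs_of_pos hpos] at h1
        have h3 := abs_le.1 h1
        linarith) t ht

/-- At Z₁ = 0 and for q < 2 the odd power is only Hölder of exponent q - 1. Any positive exponent
suffices, because it is applied to an exponentially small deviation. -/
theorem oddPow_holder_at (hq : 1 < q) (Z₁ : ℝ) :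
    ∃ θ B : ℝ, 0 < θ ∧ 0 ≤ B ∧ ∀ᶠ Z in 𝓝 Z₁, |oddPow q Z - oddPow q Z₁| ≤ B * |Z - Z₁| ^ θ := by
  rcases eq_or_ne Z₁ 0 with rfl | hZ
  · refine ⟨q - 1, 1, by linarith, zero_le_one, Eventually.of_forall fun Z => ?_⟩
    simp [abs_oddPow hq]
  · obtain ⟨B, hB, hB'⟩ := (hasDerivAt_oddPow (a := q) hZ).isBigO_sub.exists_pos
    refine ⟨1, B, one_pos, hB.le, ?_⟩
    filter_upwards [hB'.bound] with Z hZ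
    simpa using hZ

/-- The derivative of y - γ₁τ is |ζ|^(q-2) ζ minus its limit, which the Hölder bound makes
exponentially small, hence integrable. -/
theorem exists_tendsto_of_exp_rate (h : p.HolderConjugate q)
    (hζc : ∀ τ, T ≤ τ → ContinuousAt ζ τ)
    (hlim : Tendsto ζ atTop (𝓝 Z₁)) {A a : ℝ} (ha : 0 < a)
    (hr : ∀ᶠ τ in atTop, |ζ τ - Z₁| ≤ A * Real.exp (-a * τ))
    (hy : ∀ τ, T ≤ τ → HasDerivAt y (oddPow q (ζ τ)) τ) :
    ∃ L, Tendsto (fun τ => y τ - oddPow q Z₁ * τ) atTop (𝓝 L) := by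
  obtain ⟨θ, B, hθ, hB, hHol⟩ := oddPow_holder_at h.symm.lt Z₁
  obtain ⟨T', hT'⟩ := eventually_atTop.1 (((hlim.eventually hHol).and hr).and
    (eventually_ge_atTop T))
  have hA : 0 ≤ A := by
    have := (abs_nonneg _).trans (hT' T' le_rfl).1.2
    exact nonneg_of_mul_nonneg_left this (Real.exp_pos _)
  refine ⟨_, tendsto_limUnder_of_hasDerivAt_of_integrableOn_Ioi (a := T')
    (f' := fun τ => oddPow q (ζ τ) - oddPow q Z₁) (fun t ht => ?_) ?_⟩
  · exact ((hy t (hT' t (le_of_lt ht)).2).sub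
      ((hasDerivAt_id t).const_mul (oddPow q Z₁))).congr_deriv (by ring)
  · have hint : IntegrableOn (fun τ => B * A ^ θ * Real.exp (-(a * θ) * τ)) (Set.Ioi T') :=
      (exp_neg_integrableOn_Ioi T' (mul_pos ha hθ)).const_mul _
    refine Integrable.mono' hint ?_ ?_
    · refine ContinuousOn.aestronglyMeasurable (fun t ht => ?_) measurableSet_Ioi
      exact (((continuous_oddPow h.symm.lt).continuousAt.comp
        (hζc t (hT' t (le_of_lt ht)).2)).sub continuousAt_const).continuousWithinAt
    · refine (ae_restrict_iff' measurableSet_Ioi).2 (Eventually.of_forall fun t ht => ?_)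
      obtain ⟨⟨h1, h2⟩, -⟩ := hT' t (le_of_lt ht)
      rw [Real.norm_eq_abs]
      refine h1.trans ?_
      rw [mul_assoc]
      refine mul_le_mul_of_nonneg_left ?_ hB
      calc |ζ t - Z₁| ^ θ ≤ (A * Real.exp (-a * t)) ^ θ :=
            Real.rpow_le_rpow (abs_nonneg _) h2 hθ.le
        _ = A ^ θ * Real.exp (-(a * θ) * t) := by
            rw [Real.mul_rpow hA (Real.exp_pos _).le, ← Real.exp_mul]; ring_nf

/-- Asymptotics of the autonomous Emden-Fowler system in logarithmic variables. -/
theorem emdenFowler_asymptotics (h : p.HolderConjugate q) (hpn : p < n) {b lam : ℝ} (hb : 0 < b)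
    (hZ₁ : Z₁ < oddPow p ((n - p) / p)) (hZ₂ : oddPow p ((n - p) / p) < Z₂)
    (hH₁ : Ham p q n μ Z₁ = 0) (hH₂ : Ham p q n μ Z₂ = 0)
    (hζ : ∀ τ, T ≤ τ → HasDerivAt ζ (-(Ham p q n μ (ζ τ) +
      (Real.exp (b * (y τ - (n - p) / p * τ)) + lam * Real.exp (-p * τ)))) τ)
    (hy : ∀ τ, T ≤ τ → HasDerivAt y (oddPow q (ζ τ)) τ)
    (hyb : Tendsto (fun τ => y τ - (n - p) / p * τ) atTop atBot) :
    Tendsto ζ atTop (𝓝 Z₁) ∧ ∃ L, Tendsto (fun τ => y τ - oddPow q Z₁ * τ) atTop (𝓝 L) := by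
  have hp := h.pos
  set δ := (n - p) / p with hδ
  have hexp : ∀ c : ℝ, 0 < c → Tendsto (fun τ : ℝ => Real.exp (-c * τ)) atTop (𝓝 0) := fun c hc =>
    Real.tendsto_exp_atBot.comp (tendsto_id.const_mul_atTop_of_neg (neg_lt_zero.2 hc))
  have hG : Tendsto (fun τ => Real.exp (b * (y τ - δ * τ)) + lam * Real.exp (-p * τ)) atTop
      (𝓝 0) := by
    have h1 : Tendsto (fun τ => Real.exp (b * (y τ - δ * τ))) atTop (𝓝 0) :=
      Real.tendsto_exp_atBot.comp (hyb.const_mul_atBot hb)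
    simpa using h1.add ((hexp p hp).const_mul lam)
  have hlim := riccati_tendsto h hpn hZ₁ hZ₂ hH₁ hH₂ hζ hG hy hyb
  refine ⟨hlim, ?_⟩
  have hγ : oddPow q Z₁ < δ := (oddPow_lt_iff h).2 hZ₁
  -- Half the gap between γ₁ and δ: eventually y' < δ - κ, so y - δτ decreases at least linearly.
  -- This upgrades G → 0 to exponential decay at the slower of the rates bκ and p.
  set κ := (δ - oddPow q Z₁) / 2 with hκ
  have hκpos : 0 < κ := by linarith
  have hq : Tendsto (fun τ => oddPow q (ζ τ)) atTop (𝓝 (oddPow q Z₁)) :=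
    ((continuous_oddPow h.symm.lt).tendsto _).comp hlim
  obtain ⟨T', hT'⟩ := eventually_atTop.1 ((hq.eventually (gt_mem_nhds
    (show oddPow q Z₁ < δ - κ by linarith))).and (eventually_ge_atTop T))
  have hdecay : ∀ τ, T' ≤ τ → y τ - δ * τ ≤ (y T' - δ * T' + κ * T') - κ * τ := by
    intro τ hτ
    have := add_mul_le_of_hasDerivAt_ge (f := fun t => -(y t - δ * t)) (a := T') (c := κ)
      (fun t ht => ((hy t (hT' t ht).2).sub ((hasDerivAt_id t).const_mul δ)).neg)
      (fun t ht => by linarith [(hT' t ht).1]) τ hτ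
    linarith
  set D := y T' - δ * T' + κ * T'
  set a := min (b * κ) p with ha
  have hapos : 0 < a := lt_min (by positivity) hp
  obtain ⟨A, -, hA'⟩ := riccati_rate h hZ₁ hH₁ hζ hlim (C := Real.exp (b * D) + |lam|) (by positivity)
    hapos (by
      filter_upwards [eventually_ge_atTop T', eventually_ge_atTop 0] with τ hτ hτ0
      have h1 : Real.exp (b * (y τ - δ * τ)) ≤ Real.exp (b * D) * Real.exp (-a * τ) := by
        rw [← Real.exp_add]
        refine Real.exp_le_exp.2 ?_
        have h2 := mul_le_mul_of_nonneg_left (hdecay τ hτ) hb.le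
        have h3 := mul_le_mul_of_nonneg_right (min_le_left (b * κ) p) hτ0
        linarith
      have h2 : Real.exp (-p * τ) ≤ Real.exp (-a * τ) := by
        refine Real.exp_le_exp.2 ?_
        have h3 := mul_le_mul_of_nonneg_right (min_le_right (b * κ) p) hτ0
        linarith
      calc _ ≤ |Real.exp (b * (y τ - δ * τ))| + |lam * Real.exp (-p * τ)| := abs_add_le _ _
        _ = Real.exp (b * (y τ - δ * τ)) + |lam| * Real.exp (-p * τ) := by
            rw [abs_mul, abs_of_pos (Real.exp_pos _), abs_of_pos (Real.exp_pos _)]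
        _ ≤ Real.exp (b * D) * Real.exp (-a * τ) + |lam| * Real.exp (-a * τ) :=
            add_le_add h1 (mul_le_mul_of_nonneg_left h2 (abs_nonneg _))
        _ = _ := by ring)
  exact exists_tendsto_of_exp_rate h (fun τ hτ => (hζ τ hτ).continuousAt) hlim hapos hA' hy

end Riccati

/-! ### The du Bois-Reymond lemma on an interval -/

section DuBoisReymond
open Set

/-- Smooth compactly supported functions of one variable with support in `(α, β)`. -/
structure IsTest1 (α β : ℝ) (η : ℝ → ℝ) : Prop where
  smooth : ContDiff ℝ ∞ η
  compact : HasCompactSupport η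
  supp : tsupport η ⊆ Ioo α β

variable {α β : ℝ} {η f w : ℝ → ℝ}

theorem exists_Icc_of_isCompact {K : Set ℝ} (hK : IsCompact K) (hs : K ⊆ Ioo α β) {r₀ : ℝ}
    (hr : r₀ ∈ Ioo α β) :
    ∃ a b, α < a ∧ a ≤ r₀ ∧ r₀ ≤ b ∧ b < β ∧ a < b ∧ K ⊆ Ioo a b := by
  -- Inserting r₀ makes the enclosing interval contain the base point of the primitives, and makes
  -- the set nonempty.
  have hK' : IsCompact (insert r₀ K) := hK.insert r₀
  have hne : (insert r₀ K).Nonempty := insert_nonempty _ _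
  have hsub : insert r₀ K ⊆ Ioo α β := insert_subset hr hs
  have h3 : ∀ x ∈ insert r₀ K, sInf (insert r₀ K) ≤ x := fun x hx => csInf_le hK'.bddBelow hx
  have h4 : ∀ x ∈ insert r₀ K, x ≤ sSup (insert r₀ K) := fun x hx => le_csSup hK'.bddAbove hx
  obtain ⟨a, ha1, ha2⟩ := exists_between (hsub (hK'.sInf_mem hne)).1
  obtain ⟨b, hb1, hb2⟩ := exists_between (hsub (hK'.sSup_mem hne)).2
  have h5 := h3 r₀ (mem_insert _ _)
  have h6 := h4 r₀ (mem_insert _ _)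
  refine ⟨a, b, ha1, by linarith, by linarith, hb2, by linarith, fun x hx => ?_⟩
  have h7 := h3 x (mem_insert_of_mem _ hx)
  have h8 := h4 x (mem_insert_of_mem _ hx)
  exact ⟨by linarith, by linarith⟩

theorem IsTest1.deriv (hη : IsTest1 α β η) : IsTest1 α β (deriv η) :=
  ⟨((contDiff_infty_iff_deriv (𝕜 := ℝ)).1 hη.smooth).2, hη.compact.deriv,
    (tsupport_deriv_subset (𝕜 := ℝ)).trans hη.supp⟩

theorem integrable_mul_of_tsupport_subset {X : Type*} [TopologicalSpace X] [T2Space X]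
    [MeasurableSpace X] [OpensMeasurableSpace X] {ν : Measure X} {s : Set X} {f η : X → ℝ}
    (hf : LocallyIntegrableOn f s ν)
    (hη : Continuous η) (hc : HasCompactSupport η) (hs : tsupport η ⊆ s) :
    Integrable (fun x => f x * η x) ν := by
  have h1 : IntegrableOn f (tsupport η) ν := hf.integrableOn_compact_subset hs hc
  have h2 : IntegrableOn (fun x => f x * η x) (tsupport η) ν :=
    h1.mul_continuousOn hη.continuousOn hc
  refine (integrableOn_iff_integrable_of_support_subset fun x hx => ?_).1 h2
  exact subset_tsupport _ (right_ne_zero_of_mul hx)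

theorem integrable_smul_of_tsupport_subset {X F : Type*} [TopologicalSpace X] [T2Space X]
    [SecondCountableTopology X] [MeasurableSpace X] [OpensMeasurableSpace X] {ν : Measure X}
    [NormedAddCommGroup F] [NormedSpace ℝ F] {s : Set X} {f : X → F} {η : X → ℝ}
    (hf : LocallyIntegrableOn f s ν)
    (hη : Continuous η) (hc : HasCompactSupport η) (hs : tsupport η ⊆ s) :
    Integrable (fun x => η x • f x) ν := by
  have h1 : IntegrableOn f (tsupport η) ν := hf.integrableOn_compact_subset hs hc
  have h2 : IntegrableOn (fun x => η x • f x) (tsupport η) ν :=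
    h1.continuousOn_smul hη.continuousOn hc
  refine (integrableOn_iff_integrable_of_support_subset fun x hx => ?_).1 h2
  exact subset_tsupport _ (left_ne_zero_of_smul hx)

theorem intervalIntegrable_of_locallyIntegrableOn (hw : LocallyIntegrableOn w (Ioo α β))
    {a b : ℝ} (ha : a ∈ Ioo α β) (hb : b ∈ Ioo α β) : IntervalIntegrable w volume a b :=
  intervalIntegrable_iff.2 ((hw.integrableOn_compact_subset
    (ordConnected_Ioo.uIcc_subset ha hb) isCompact_uIcc).mono_set uIoc_subset_uIcc)

theorem continuousOn_primitive_of_mem (hw : LocallyIntegrableOn w (Ioo α β)) {r₀ : ℝ}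
    (hr : r₀ ∈ Ioo α β) : ContinuousOn (fun x => ∫ t in r₀..x, w t) (Ioo α β) := by
  intro x hx
  obtain ⟨a, ha1, ha2⟩ := exists_between (lt_min hr.1 hx.1)
  obtain ⟨b, hb1, hb2⟩ := exists_between (max_lt hr.2 hx.2)
  have hab := intervalIntegrable_of_locallyIntegrableOn hw
    (a := a) (b := b) ⟨ha1, by linarith [min_le_left r₀ x, le_max_left r₀ x]⟩
    ⟨by linarith [min_le_left r₀ x, le_max_left r₀ x], hb2⟩
  have h := intervalIntegral.continuousOn_primitive_interval' hab (a := r₀)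
    (mem_uIcc_of_le (by linarith [min_le_left r₀ x]) (by linarith [le_max_left r₀ x]))
  refine (h.continuousAt ?_).continuousWithinAt
  rw [uIcc_of_le (by linarith [min_le_left r₀ x, le_max_left r₀ x])]
  exact Icc_mem_nhds (by linarith [min_le_right r₀ x]) (by linarith [le_max_right r₀ x])

/-- Integration by parts for absolutely continuous functions on a compact interval around the
support of η; the boundary terms vanish and the primitive has derivative w almost everywhere. -/
theorem integral_primitive_mul_deriv (hw : LocallyIntegrableOn w (Ioo α β)) {r₀ : ℝ}
    (hr : r₀ ∈ Ioo α β) (hη : IsTest1 α β η) :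
    ∫ x, (∫ t in r₀..x, w t) * deriv η x = -∫ x, w x * η x := by
  obtain ⟨a, b, ha, har, hrb, hb, hab, hs⟩ := exists_Icc_of_isCompact hη.compact hη.supp hr
  have hint := intervalIntegrable_of_locallyIntegrableOn hw (a := a) (b := b)
    ⟨ha, by linarith⟩ ⟨by linarith, hb⟩
  have hac := hint.absolutelyContinuousOnInterval_intervalIntegral (c := r₀)
    (mem_uIcc_of_le har hrb)
  have hηac : AbsolutelyContinuousOnInterval η a b :=
    ContDiffOn.absolutelyContinuousOnInterval (hη.smooth.of_le (by simp)).contDiffOn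
  have hparts := hac.integral_mul_deriv_eq_deriv_mul hηac
  have hηa : η a = 0 := image_eq_zero_of_notMem_tsupport fun h => lt_irrefl _ (hs h).1
  have hηb : η b = 0 := image_eq_zero_of_notMem_tsupport fun h => lt_irrefl _ (hs h).2
  rw [hηa, hηb, mul_zero, mul_zero, sub_zero, zero_sub] at hparts
  have e : ∫ x in a..b, deriv (fun x => ∫ t in r₀..x, w t) x * η x = ∫ x in a..b, w x * η x := by
    refine intervalIntegral.integral_congr_ae ?_
    filter_upwards [hint.ae_hasDerivAt_integral] with x hx hxm
    rw [(hx (uIoc_subset_uIcc hxm) r₀ (mem_uIcc_of_le har hrb)).deriv]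
  rw [e] at hparts
  rw [← intervalIntegral.integral_eq_integral_of_support_subset (a := a) (b := b),
    ← intervalIntegral.integral_eq_integral_of_support_subset (f := fun x => w x * η x)
      (a := a) (b := b)]
  · exact hparts
  · exact fun x hx => Ioo_subset_Ioc_self (hs (subset_tsupport _ (right_ne_zero_of_mul hx)))
  · exact fun x hx => Ioo_subset_Ioc_self (hs (tsupport_deriv_subset (𝕜 := ℝ)
      (subset_tsupport _ (right_ne_zero_of_mul hx))))

theorem exists_isTest1_integral_eq_one (hαβ : α < β) :
    ∃ η, IsTest1 α β η ∧ ∫ x, η x = 1 := by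
  let φ : ContDiffBump ((α + β) / 2) :=
    ⟨(β - α) / 8, (β - α) / 4, by linarith, by linarith⟩
  refine ⟨φ.normed volume, ⟨φ.contDiff_normed, φ.hasCompactSupport_normed, ?_⟩, φ.integral_normed⟩
  rw [φ.tsupport_normed_eq, Real.closedBall_eq_Icc]
  intro x hx
  have h1 : φ.rOut = (β - α) / 4 := rfl
  rw [h1] at hx
  constructor <;> linarith [hx.1, hx.2]

/-- The primitive from the left of the support is constant to its right, and that constant is the
integral of η. Zero mean is thus what gives compact support. -/
theorem IsTest1.exists_primitive (hη : IsTest1 α β η) (hαβ : α < β) (h0 : ∫ x, η x = 0) :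
    ∃ h, IsTest1 α β h ∧ _root_.deriv h = η := by
  obtain ⟨a, b, ha, -, -, hb, hab, hs⟩ := exists_Icc_of_isCompact hη.compact hη.supp (r₀ := (α + β) / 2)
    ⟨by linarith, by linarith⟩
  have hc : Continuous η := hη.smooth.continuous
  have hd : ∀ x, HasDerivAt (fun x => ∫ t in a..x, η t) (η x) x := fun x =>
    hc.integral_hasStrictDerivAt a x |>.hasDerivAt
  have hd' : _root_.deriv (fun x => ∫ t in a..x, η t) = η := funext fun x => (hd x).deriv
  have hz : ∀ x, x ∉ Ioo a b → η x = 0 := fun x hx =>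
    image_eq_zero_of_notMem_tsupport fun h => hx (hs h)
  have hout : ∀ x, x ∉ Icc a b → (∫ t in a..x, η t) = 0 := by
    intro x hx
    rcases lt_or_ge x a with h | h
    · rw [intervalIntegral.integral_congr (g := fun _ => 0), intervalIntegral.integral_zero]
      intro t ht
      rw [uIcc_of_ge h.le] at ht
      exact hz t fun h' => by linarith [ht.2, h'.1]
    · have hbx : b < x := by by_contra! h'; exact hx ⟨h, h'⟩
      rw [intervalIntegral.integral_eq_integral_of_support_subset, h0]
      intro t ht
      have := hs (subset_tsupport _ ht)
      exact ⟨this.1, by linarith [this.2]⟩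
  have hsupp : tsupport (fun x => ∫ t in a..x, η t) ⊆ Icc a b := by
    refine closure_minimal (fun x hx => ?_) isClosed_Icc
    by_contra h
    exact hx (hout x h)
  refine ⟨_, ⟨?_, ?_, hsupp.trans (Icc_subset_Ioo ha hb)⟩, hd'⟩
  · rw [contDiff_infty_iff_deriv]
    exact ⟨fun x => (hd x).differentiableAt, by rw [hd']; exact hη.smooth⟩
  · exact HasCompactSupport.of_support_subset_isCompact isCompact_Icc
      ((subset_tsupport _).trans hsupp)

/-- Fix η₀ of integral one. Each test function g is (∫ g) η₀ plus a function of mean zero, which is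
the derivative of a test function and so is annihilated by f. Hence f minus the number ∫ f η₀
annihilates every g. -/
theorem ae_eq_const_of_weak_deriv_zero (hαβ : α < β) (hf : LocallyIntegrableOn f (Ioo α β))
    (h : ∀ η, IsTest1 α β η → ∫ x, f x * deriv η x = 0) :
    ∃ c, ∀ᵐ x, x ∈ Ioo α β → f x = c := by
  obtain ⟨η₀, hη₀, hη₀'⟩ := exists_isTest1_integral_eq_one hαβ
  refine ⟨∫ x, f x * η₀ x, ?_⟩
  have hmain : ∀ᵐ x, x ∈ Ioo α β → f x - ∫ x, f x * η₀ x = 0 := by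
    refine isOpen_Ioo.ae_eq_zero_of_integral_contDiff_smul_eq_zero ?_ ?_
    · exact hf.sub ((locallyIntegrable_const _).locallyIntegrableOn _)
    · intro g hg hgc hgs
      have hgi : Integrable g := hg.continuous.integrable_of_hasCompactSupport hgc
      have hη₀i : Integrable η₀ := hη₀.smooth.continuous.integrable_of_hasCompactSupport hη₀.compact
      have htest : IsTest1 α β (fun x => g x - (∫ x, g x) * η₀ x) := by
        refine ⟨hg.sub (contDiff_const.mul hη₀.smooth), ?_, ?_⟩
        · exact hgc.sub hη₀.compact.mul_left
        · refine (tsupport_sub _ _).trans (union_subset hgs ?_)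
          exact (tsupport_mul_subset_right).trans hη₀.supp
      obtain ⟨H, hH, hHd⟩ := htest.exists_primitive hαβ (by
        rw [integral_sub hgi (hη₀i.const_mul _), integral_const_mul, hη₀']; ring)
      have h1 := h H hH
      rw [hHd] at h1
      have i1 := integrable_mul_of_tsupport_subset hf hg.continuous hgc hgs
      have i2 := integrable_mul_of_tsupport_subset hf hη₀.smooth.continuous hη₀.compact hη₀.supp
      have e1 : (fun x => f x * (g x - (∫ x, g x) * η₀ x)) =
          fun x => f x * g x - (∫ x, g x) * (f x * η₀ x) := by funext x; ring
      rw [e1, integral_sub i1 (i2.const_mul _), integral_const_mul] at h1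
      have e2 : (fun x => g x • (f x - ∫ x, f x * η₀ x)) =
          fun x => f x * g x - (∫ x, f x * η₀ x) * g x := by funext x; simp only [smul_eq_mul]; ring
      rw [e2, integral_sub i1 (hgi.const_mul _), integral_const_mul]
      linarith
  filter_upwards [hmain] with x hx hxm
  linarith [hx hxm]

/-- The du Bois-Reymond lemma: a function with a weak derivative on an interval is a primitive. -/
theorem ae_eq_primitive_of_weak_deriv (hαβ : α < β) (hf : LocallyIntegrableOn f (Ioo α β))
    (hw : LocallyIntegrableOn w (Ioo α β))
    (h : ∀ η, IsTest1 α β η → ∫ x, f x * deriv η x = -∫ x, w x * η x)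
    {r₀ : ℝ} (hr : r₀ ∈ Ioo α β) :
    ∃ c, ∀ᵐ x, x ∈ Ioo α β → f x = c + ∫ t in r₀..x, w t := by
  have hW : LocallyIntegrableOn (fun x => ∫ t in r₀..x, w t) (Ioo α β) :=
    (continuousOn_primitive_of_mem hw hr).locallyIntegrableOn measurableSet_Ioo
  obtain ⟨c, hc⟩ := ae_eq_const_of_weak_deriv_zero hαβ (hf.sub hW) (fun η hη => by
    have i1 := integrable_mul_of_tsupport_subset hf hη.deriv.smooth.continuous hη.deriv.compact
      hη.deriv.supp
    have i2 := integrable_mul_of_tsupport_subset hW hη.deriv.smooth.continuous hη.deriv.compact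
      hη.deriv.supp
    simp only [Pi.sub_apply, sub_mul]
    rw [integral_sub i1 i2, h η hη, integral_primitive_mul_deriv hw hr hη]
    ring)
  refine ⟨c, ?_⟩
  filter_upwards [hc] with x hx hxm
  have := hx hxm
  simp only [Pi.sub_apply] at this
  linarith

end DuBoisReymond

/-! ### Integration by parts in W₀^{1,p} -/

section WeakGradient
open Set

variable {N : ℕ} {p : ℝ} {Ω : Set (E N)} {u : E N → ℝ} {Du : E N → E N}

/-- On a finite measure space L^p convergence implies L¹ convergence, and the bound by K carries it
over to the integrands. -/
theorem tendsto_setIntegral_of_tendsto_eLpNorm {F : Type*} [NormedAddCommGroup F]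
    {X : Type*} [MeasurableSpace X] {ν : Measure X}
    [IsFiniteMeasure ν] (hp : 1 ≤ p) {g : X → F} {gn : ℕ → X → F} {k : X → ℝ} {kn : ℕ → X → ℝ}
    (hg : MemLp g (ENNReal.ofReal p) ν) (hgn : ∀ n, AEStronglyMeasurable (gn n) ν)
    (hlim : Tendsto (fun n => eLpNorm (fun x => gn n x - g x) (ENNReal.ofReal p) ν) atTop (𝓝 0))
    (hk : Integrable k ν) (hkn : ∀ n, Integrable (kn n) ν) {K : ℝ}
    (hK : ∀ n x, |kn n x - k x| ≤ K * ‖gn n x - g x‖) :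
    Tendsto (fun n => ∫ x, kn n x ∂ν) atTop (𝓝 (∫ x, k x ∂ν)) := by
  refine tendsto_integral_of_L1' k hk.aestronglyMeasurable (Eventually.of_forall hkn) ?_
  have hp' : (1 : ENNReal) ≤ ENNReal.ofReal p := by simpa using hp
  set C : ENNReal := ν univ ^ (1 / (1 : ENNReal).toReal - 1 / (ENNReal.ofReal p).toReal)
  have hC : C ≠ ⊤ := by
    refine ENNReal.rpow_ne_top_of_nonneg ?_ (measure_ne_top _ _)
    rw [ENNReal.toReal_ofReal (by linarith)]
    simp only [ENNReal.toReal_one, div_one, one_div, sub_nonneg]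
    exact inv_le_one_of_one_le₀ hp
  have hb : Tendsto (fun n => ENNReal.ofReal K *
      (eLpNorm (fun x => gn n x - g x) (ENNReal.ofReal p) ν * C)) atTop (𝓝 0) := by
    have h1 := ENNReal.Tendsto.mul_const hlim (Or.inr hC)
    have h2 := ENNReal.Tendsto.const_mul h1 (Or.inr (ENNReal.ofReal_ne_top (r := K)))
    simpa using h2
  refine tendsto_of_tendsto_of_tendsto_of_le_of_le tendsto_const_nhds hb (fun _ => bot_le)
    fun n => ?_
  refine (eLpNorm_le_mul_eLpNorm_of_ae_le_mul (g := fun x => gn n x - g x)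
    (Eventually.of_forall fun x => by simpa using hK n x) 1).trans ?_
  gcongr
  exact eLpNorm_le_eLpNorm_mul_rpow_measure_univ hp' ((hgn n).sub hg.aestronglyMeasurable)

theorem inner_gradient_eq_fderiv {φ : E N → ℝ} (x e : E N) :
    inner ℝ (gradient φ x) e = fderiv ℝ φ x e := by
  simp [gradient]

theorem continuous_gradient {φ : E N → ℝ} (hφ : ContDiff ℝ 1 φ) : Continuous (gradient φ) :=
  (InnerProductSpace.toDual ℝ (E N)).symm.continuous.comp (hφ.continuous_fderiv one_ne_zero)

theorem integral_mul_fderiv_of_hasCompactSupport {φ ψ : E N → ℝ} (hφ : ContDiff ℝ 1 φ)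
    (hψ : ContDiff ℝ 1 ψ) (hc : HasCompactSupport ψ) (e : E N) :
    ∫ x, φ x * fderiv ℝ ψ x e = -∫ x, fderiv ℝ φ x e * ψ x := by
  have c1 : Continuous fun x => fderiv ℝ φ x e :=
    (hφ.continuous_fderiv one_ne_zero).clm_apply continuous_const
  have c2 : Continuous fun x => fderiv ℝ ψ x e :=
    (hψ.continuous_fderiv one_ne_zero).clm_apply continuous_const
  have hc2 : HasCompactSupport fun x => fderiv ℝ ψ x e := hc.fderiv_apply (𝕜 := ℝ) e
  refine integral_mul_fderiv_eq_neg_fderiv_mul_of_integrable ?_ ?_ ?_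
    (fun x _ => (hφ.differentiable one_ne_zero) x) (fun x _ => (hψ.differentiable one_ne_zero) x)
  · exact (c1.mul hψ.continuous).integrable_of_hasCompactSupport hc.mul_left
  · exact (hφ.continuous.mul c2).integrable_of_hasCompactSupport hc2.mul_left
  · exact (hφ.continuous.mul hψ.continuous).integrable_of_hasCompactSupport hc.mul_left

/-- Integration by parts for functions in `W₀^{1,p}`. -/
theorem MemW01p.integral_mul_fderiv (h : MemW01p p Ω u Du) (hp : 1 ≤ p)
    [IsFiniteMeasure (volume.restrict Ω)] {ψ : E N → ℝ}
    (hψ : ContDiff ℝ 1 ψ) (hc : HasCompactSupport ψ) (e : E N) :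
    ∫ x in Ω, u x * fderiv ℝ ψ x e = -∫ x in Ω, inner ℝ (Du x) e * ψ x := by
  have hp' : (1 : ENNReal) ≤ ENNReal.ofReal p := by simpa using hp
  obtain ⟨φ, hφ, hlim, hlim'⟩ := h.approx
  have c2 : Continuous fun x => fderiv ℝ ψ x e :=
    (hψ.continuous_fderiv one_ne_zero).clm_apply continuous_const
  have hc2 : HasCompactSupport fun x => fderiv ℝ ψ x e := hc.fderiv_apply (𝕜 := ℝ) e
  obtain ⟨K₁, hK₁⟩ := c2.bounded_above_of_compact_support hc2
  obtain ⟨K₂, hK₂⟩ := hψ.continuous.bounded_above_of_compact_support hc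
  have hφ1 : ∀ n, ContDiff ℝ 1 (φ n) := fun n => (hφ n).smooth.of_le (by simp)
  have hu : Integrable u (volume.restrict Ω) := h.memLp.integrable hp'
  have hDu : Integrable Du (volume.restrict Ω) := h.memLp_grad.integrable hp'
  have cφ' : ∀ n, Continuous fun x => fderiv ℝ (φ n) x e := fun n =>
    ((hφ1 n).continuous_fderiv one_ne_zero).clm_apply continuous_const
  have t1 := tendsto_setIntegral_of_tendsto_eLpNorm hp h.memLp
    (fun n => (hφ n).smooth.continuous.aestronglyMeasurable) hlim
    (k := fun x => u x * fderiv ℝ ψ x e) (kn := fun n x => φ n x * fderiv ℝ ψ x e) (K := K₁)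
    (hu.mul_bdd c2.aestronglyMeasurable (Eventually.of_forall hK₁))
    (fun n => (((hφ n).smooth.continuous.mul c2).integrable_of_hasCompactSupport
      hc2.mul_left).restrict)
    (fun n x => by
      rw [← sub_mul, abs_mul, mul_comm]
      exact mul_le_mul_of_nonneg_right (hK₁ x) (abs_nonneg _))
  have t2 := tendsto_setIntegral_of_tendsto_eLpNorm hp h.memLp_grad
    (fun n => (continuous_gradient (hφ1 n)).aestronglyMeasurable) hlim'
    (k := fun x => inner ℝ (Du x) e * ψ x) (kn := fun n x => fderiv ℝ (φ n) x e * ψ x)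
    (K := ‖e‖ * K₂)
    ((hDu.inner_const e).mul_bdd hψ.continuous.aestronglyMeasurable (Eventually.of_forall hK₂))
    (fun n => (((cφ' n).mul hψ.continuous).integrable_of_hasCompactSupport
      hc.mul_left).restrict)
    (fun n x => by
      rw [← sub_mul, abs_mul, ← inner_gradient_eq_fderiv, ← inner_sub_left]
      calc _ ≤ (‖gradient (φ n) x - Du x‖ * ‖e‖) * K₂ :=
            mul_le_mul (abs_real_inner_le_norm _ _) (hK₂ x) (abs_nonneg _) (by positivity)
        _ = _ := by ring)
  -- The approximants vanish outside Ω, so the identity on the whole space applies and ψ need not be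
  -- supported in Ω.
  have heq : ∀ n, ∫ x in Ω, φ n x * fderiv ℝ ψ x e = -∫ x in Ω, fderiv ℝ (φ n) x e * ψ x := by
    intro n
    rw [setIntegral_eq_integral_of_forall_compl_eq_zero,
      setIntegral_eq_integral_of_forall_compl_eq_zero,
      integral_mul_fderiv_of_hasCompactSupport (hφ1 n) hψ hc e]
    · intro x hx
      have : x ∉ tsupport (fderiv ℝ (φ n)) := fun h' =>
        hx ((hφ n).supp (tsupport_fderiv_subset ℝ h'))
      rw [image_eq_zero_of_notMem_tsupport this]; simp
    · intro x hx
      rw [image_eq_zero_of_notMem_tsupport (fun h' => hx ((hφ n).supp h')), zero_mul]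
  simp only [heq] at t1
  exact tendsto_nhds_unique t1 t2.neg

end WeakGradient

/-! ### Polar coordinates -/

section Polar
open Set
variable {N : ℕ}

theorem integral_volumeIoiPow (n : ℕ) (g : ℝ → ℝ) :
    ∫ x : Ioi (0 : ℝ), g x ∂(Measure.volumeIoiPow n) = ∫ r in Ioi (0 : ℝ), r ^ n * g r := by
  simp only [Measure.volumeIoiPow, ENNReal.ofReal]
  rw [integral_withDensity_eq_integral_smul,
    integral_subtype_comap measurableSet_Ioi fun a ↦ Real.toNNReal (a ^ n) • g a,
    setIntegral_congr_fun measurableSet_Ioi fun x hx ↦ ?_]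
  · rw [NNReal.smul_def, Real.coe_toNNReal _ (pow_nonneg (le_of_lt hx) _), smul_eq_mul]
  · exact (measurable_subtype_coe.pow_const _).real_toNNReal

theorem integrable_volumeIoiPow_iff (n : ℕ) (g : ℝ → ℝ) :
    Integrable (fun x : Ioi (0 : ℝ) => g x) (Measure.volumeIoiPow n) ↔
      IntegrableOn (fun r => r ^ n * g r) (Ioi 0) := by
  rw [integrableOn_iff_comap_subtypeVal measurableSet_Ioi, Measure.volumeIoiPow,
    integrable_withDensity_iff_integrable_smul']
  · refine integrable_congr (Eventually.of_forall ?_)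
    rintro ⟨x, hx : 0 < x⟩
    simp (disch := positivity) [ENNReal.toReal_ofReal]
  · fun_prop
  · simp

/-- The integral of `F` over the sphere of radius `r`, without the Jacobian factor. -/
noncomputable def sphereInt (F : E N → ℝ) (r : ℝ) : ℝ :=
  ∫ θ : Metric.sphere (0 : E N) 1, F (r • (θ : E N)) ∂(volume : Measure (E N)).toSphere

theorem polar_integrable {F : E N → ℝ} (hF : Integrable F) :
    Integrable (fun z : Metric.sphere (0 : E N) 1 × Ioi (0 : ℝ) => F ((z.2 : ℝ) • (z.1 : E N)))
      ((volume : Measure (E N)).toSphere.prod (Measure.volumeIoiPow (N - 1))) := by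
  have hmp := (volume : Measure (E N)).measurePreserving_homeomorphUnitSphereProd
  rw [finrank_euclideanSpace_fin] at hmp
  rw [← hmp.integrable_comp_emb (Homeomorph.measurableEmbedding _)]
  have h1 : Integrable (fun x : ({0}ᶜ : Set (E N)) => F x.1) (volume.comap Subtype.val) := by
    have := (integrableOn_iff_comap_subtypeVal (μ := volume) (f := F)
      (measurableSet_singleton (0 : E N)).compl).1 hF.integrableOn
    exact this
  refine h1.congr (Eventually.of_forall fun x => ?_)
  have hx : ‖(x : E N)‖ ≠ 0 := norm_ne_zero_iff.2 x.2
  simp [smul_smul, hx]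

theorem integrableOn_sphereInt {F : E N → ℝ} (hF : Integrable F) :
    IntegrableOn (fun r => r ^ (N - 1) * sphereInt F r) (Ioi 0) :=
  (integrable_volumeIoiPow_iff _ _).1 (polar_integrable hF).integral_prod_right

/-- The origin is null, and the punctured space is the product of sphere and half-line with measure
r^(N-1) dr, so this is Fubini. The integrand need not be radial, as is required for the pairing of
`Du` with x. -/
theorem integral_eq_sphereInt [Nontrivial (E N)] {F : E N → ℝ} (hF : Integrable F) :
    ∫ x, F x = ∫ r in Ioi (0 : ℝ), r ^ (N - 1) * sphereInt F r := by
  have hmp := (volume : Measure (E N)).measurePreserving_homeomorphUnitSphereProd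
  rw [finrank_euclideanSpace_fin] at hmp
  rw [← integral_volumeIoiPow, ← restrict_compl_singleton (μ := volume) (0 : E N),
    ← integral_subtype_comap (measurableSet_singleton (0 : E N)).compl]
  unfold sphereInt
  rw [← integral_prod_symm _ (polar_integrable hF), ← hmp.integral_comp
    (Homeomorph.measurableEmbedding _)]
  refine integral_congr_ae (Eventually.of_forall fun x => ?_)
  have hx : ‖(x : E N)‖ ≠ 0 := norm_ne_zero_iff.2 x.2
  simp [smul_smul, hx]

theorem sphereInt_mul_radial (F : E N → ℝ) (k : ℝ → ℝ) {r : ℝ} (hr : 0 < r) :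
    sphereInt (fun x => F x * k ‖x‖) r = sphereInt F r * k r := by
  unfold sphereInt
  rw [← integral_mul_const]
  congr 1
  funext θ
  have : ‖(θ : E N)‖ = 1 := by simp
  simp [norm_smul, this, abs_of_pos hr]

/-- In polar coordinates, the indicator of a measurable null set of radii integrates to zero over
the space. -/
theorem ae_norm_of_ae [Nontrivial (E N)] {R : ℝ} {P : ℝ → Prop} (h : ∀ᵐ r, r ∈ Ioo 0 R → P r) :
    ∀ᵐ x : E N, x ∈ Metric.ball (0 : E N) R → P ‖x‖ := by
  set S := {r | ¬(r ∈ Ioo 0 R → P r)}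
  have hS : volume S = 0 := h
  set M := toMeasurable volume S
  have hM : volume M = 0 := by rw [measure_toMeasurable, hS]
  have hMm : MeasurableSet M := measurableSet_toMeasurable _ _
  have hae : ∀ᵐ r, r ∉ M := measure_eq_zero_iff_ae_notMem.1 hM
  have h0 : (fun r : ℝ => r ^ (Module.finrank ℝ (E N) - 1) • M.indicator (fun _ => (1 : ℝ)) r)
      =ᵐ[volume.restrict (Ioi 0)] 0 := by
    filter_upwards [ae_restrict_of_ae hae] with r hr
    simp [indicator_of_notMem hr]
  have hi : Integrable (fun x : E N => M.indicator (fun _ => (1 : ℝ)) ‖x‖) := by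
    rw [integrable_fun_norm_addHaar volume (f := M.indicator (fun _ => (1 : ℝ)))]
    exact (integrable_zero _ _ _).congr h0.symm
  have hz : ∫ x : E N, M.indicator (fun _ => (1 : ℝ)) ‖x‖ = 0 := by
    rw [integral_fun_norm_addHaar volume, integral_congr_ae h0]; simp
  rw [integral_eq_zero_iff_of_nonneg
    (fun x => indicator_nonneg (fun _ _ => zero_le_one) _) hi] at hz
  have hne : ∀ᵐ x : E N, x ≠ 0 := by simp [ae_iff]
  filter_upwards [hz, hne] with x hx hx0 hxR
  by_contra hP
  have : ‖x‖ ∈ M := subset_toMeasurable _ _ (by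
    simp only [S, mem_ofPred_eq, Classical.not_imp]
    exact ⟨⟨norm_pos_iff.2 hx0, by simpa using hxR⟩, hP⟩)
  simp [indicator_of_mem this] at hx

end Polar

/-! ### Radial functions and radial test functions -/

section Radial
open Set
variable {N : ℕ} {R : ℝ} {η w : ℝ → ℝ}

theorem contDiff_of_forall_tsupport {V : Type*} [NormedAddCommGroup V] [NormedSpace ℝ V]
    {f : V → ℝ} {k : WithTop ℕ∞} (h : ∀ x ∈ tsupport f, ContDiffAt ℝ k f x) : ContDiff ℝ k f :=
  contDiff_iff_contDiffAt.2 fun x => by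
    by_cases hx : x ∈ tsupport f
    · exact h x hx
    · exact contDiffAt_const.congr_of_eventuallyEq (notMem_tsupport_iff_eventuallyEq.1 hx)

theorem hasFDerivAt_norm_of_ne {x : E N} (hx : x ≠ 0) :
    HasFDerivAt (fun x : E N => ‖x‖) (‖x‖⁻¹ • innerSL ℝ x) x := by
  have hx' : ‖x‖ ≠ 0 := norm_ne_zero_iff.2 hx
  have h1 := (hasStrictFDerivAt_norm_sq x).hasFDerivAt.sqrt (pow_ne_zero 2 hx')
  have h2 : (fun x : E N => √(‖x‖ ^ 2)) = fun x => ‖x‖ :=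
    funext fun x => Real.sqrt_sq (norm_nonneg _)
  rw [h2] at h1
  refine h1.congr_fderiv ?_
  rw [Real.sqrt_sq (norm_nonneg _)]
  ext y
  simp
  field_simp

theorem hasFDerivAt_radial {U : ℝ → ℝ} {U' : ℝ} {x : E N} (hx : x ≠ 0)
    (hU : HasDerivAt U U' ‖x‖) :
    HasFDerivAt (fun x : E N => U ‖x‖) ((U' * ‖x‖⁻¹) • innerSL ℝ x) x := by
  have := hU.comp_hasFDerivAt x (hasFDerivAt_norm_of_ne hx)
  rwa [smul_smul] at this

theorem tsupport_radial_subset (η : ℝ → ℝ) :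
    tsupport (fun x : E N => η ‖x‖) ⊆ {x | ‖x‖ ∈ tsupport η} :=
  closure_minimal (fun _ hx => subset_tsupport η hx)
    ((isClosed_tsupport η).preimage continuous_norm)

theorem IsTest1.tsupport_radial (hη : IsTest1 0 R η) :
    tsupport (fun x : E N => η ‖x‖) ⊆ Metric.ball 0 R \ {0} := fun x hx => by
  have := hη.supp (tsupport_radial_subset η hx)
  exact ⟨by simpa using this.2, fun h => by simp [mem_singleton_iff.1 h] at this⟩

/-- The norm is singular only at the origin, and the profile vanishes near 0. -/
theorem IsTest1.radial (hη : IsTest1 0 R η) : IsTest (Metric.ball 0 R) (fun x : E N => η ‖x‖) where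
  smooth := contDiff_of_forall_tsupport fun x hx =>
    hη.smooth.contDiffAt.comp x (contDiffAt_norm ℝ (hη.tsupport_radial hx).2)
  compact := HasCompactSupport.of_support_subset_isCompact (isCompact_closedBall (0 : E N) R)
    fun _ hx => Metric.ball_subset_closedBall (hη.tsupport_radial (subset_tsupport _ hx)).1
  supp := fun _ hx => (hη.tsupport_radial hx).1

theorem IsTest1.mul_inv_pow (hη : IsTest1 0 R η) (n : ℕ) :
    IsTest1 0 R (fun r => η r * (r ^ n)⁻¹) where
  smooth := contDiff_of_forall_tsupport fun r hr => by
    have : 0 < r := (hη.supp (tsupport_mul_subset_left hr)).1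
    exact hη.smooth.contDiffAt.mul ((contDiffAt_id.pow n).inv (pow_ne_zero n this.ne'))
  compact := hη.compact.mul_right
  supp := tsupport_mul_subset_left.trans hη.supp

theorem locallyIntegrableOn_radial [Nontrivial (E N)] (hw : LocallyIntegrableOn w (Ioo 0 R)) :
    LocallyIntegrableOn (fun x : E N => w ‖x‖) (Metric.ball 0 R \ {0}) := by
  have hopen : IsOpen (Metric.ball (0 : E N) R \ {0}) :=
    Metric.isOpen_ball.sdiff isClosed_singleton
  rw [locallyIntegrableOn_iff hopen.isLocallyClosed]
  intro k hk hkc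
  have hK : IsCompact (norm '' k) := hkc.image continuous_norm
  have hsub : norm '' k ⊆ Ioo 0 R := by
    rintro _ ⟨x, hx, rfl⟩
    exact ⟨norm_pos_iff.2 (hk hx).2, by simpa using (hk hx).1⟩
  have h1 : IntegrableOn w (norm '' k) := hw.integrableOn_compact_subset hsub hK
  have h2 : Integrable (fun x : E N => (norm '' k).indicator w ‖x‖) := by
    rw [integrable_fun_norm_addHaar volume (f := (norm '' k).indicator w)]
    have h3 : IntegrableOn (fun r => r ^ (Module.finrank ℝ (E N) - 1) * w r) (norm '' k) :=
      h1.continuousOn_mul (by fun_prop) hK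
    have h4 := (integrable_indicator_iff hK.measurableSet).2 h3
    refine (h4.congr (Eventually.of_forall fun r => ?_)).integrableOn
    by_cases hr : r ∈ norm '' k <;> simp [hr]
  refine (h2.integrableOn (s := k)).congr_fun (fun x hx => ?_) hkc.measurableSet
  simp [indicator_of_mem (mem_image_of_mem norm hx)]

end Radial

/-! ### The radial weak derivative -/

section RadialWeakGradient
open Set
theorem integrable_indicator_inner {N : ℕ} {R : ℝ} {Du : E N → E N}
    (hDu : IntegrableOn Du (Metric.ball 0 R)) :
    Integrable ((Metric.ball (0 : E N) R).indicator fun x => inner ℝ (Du x) x) := by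
  rw [integrable_indicator_iff measurableSet_ball]
  refine Integrable.mono' (g := fun x => ‖Du x‖ * R) (hDu.norm.mul_const R) ?_ ?_
  · exact hDu.aestronglyMeasurable.inner continuous_id.aestronglyMeasurable
  · filter_upwards [ae_restrict_mem measurableSet_ball] with x hx
    have : ‖x‖ ≤ R := by simpa using (Metric.mem_ball.1 hx).le
    exact (norm_inner_le_norm _ _).trans (mul_le_mul_of_nonneg_left this (norm_nonneg _))

/-- Summed over i, this is the divergence k'(|x|) |x| + N k(|x|) of the field k(|x|) x. -/
theorem fderiv_radial_mul_coord {N : ℕ} {k : ℝ → ℝ} (hk : Differentiable ℝ k) {x : E N} (hx : x ≠ 0)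
    (i : Fin N) :
    fderiv ℝ (fun x : E N => k ‖x‖ * x i) x (EuclideanSpace.single i 1) =
      deriv k ‖x‖ * ‖x‖⁻¹ * x i ^ 2 + k ‖x‖ := by
  have h1 := hasFDerivAt_radial hx (hk ‖x‖).hasDerivAt
  have h2 : HasFDerivAt (fun x : E N => x i) (EuclideanSpace.proj (𝕜 := ℝ) i : E N →L[ℝ] ℝ) x :=
    (EuclideanSpace.proj (𝕜 := ℝ) i : E N →L[ℝ] ℝ).hasFDerivAt
  have h3 : HasFDerivAt (fun x : E N => k ‖x‖ * x i) _ x := h1.mul h2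
  rw [h3.fderiv]
  simp [EuclideanSpace.inner_single_right]
  ring

variable {N : ℕ} [Nontrivial (E N)] {p R : ℝ} {u : E N → ℝ} {Du : E N → E N} {f w : ℝ → ℝ}

/-- The area of the unit sphere of `E N`. -/
noncomputable def sphereArea (N : ℕ) : ℝ := N * volume.real (Metric.ball (0 : E N) 1)

theorem sphereArea_pos : 0 < sphereArea N := by
  have h1 : 0 < N := by
    rcases Nat.eq_zero_or_pos N with rfl | h
    · exact absurd (inferInstance : Subsingleton (E 0)) (not_subsingleton _)
    · exact h
  have h2 : 0 < volume.real (Metric.ball (0 : E N) 1) :=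
    ENNReal.toReal_pos (Metric.measure_ball_pos _ _ one_pos).ne' measure_ball_lt_top.ne
  unfold sphereArea; positivity

theorem integral_radial (g : ℝ → ℝ) :
    ∫ x : E N, g ‖x‖ = sphereArea N * ∫ r in Ioi (0 : ℝ), r ^ (N - 1) * g r := by
  rw [integral_fun_norm_addHaar volume g, finrank_euclideanSpace_fin]
  simp [sphereArea, mul_assoc]

theorem integral_Ioi_eq_of_isTest1 {g η : ℝ → ℝ} (hη : IsTest1 0 R η) :
    ∫ r in Ioi (0 : ℝ), g r * η r = ∫ r, g r * η r :=
  setIntegral_eq_integral_of_forall_compl_eq_zero fun r hr => by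
    rw [image_eq_zero_of_notMem_tsupport fun h => hr (hη.supp h).1, mul_zero]

theorem locallyIntegrableOn_of_radial (hu : IntegrableOn u (Metric.ball 0 R))
    (hf : ∀ᵐ x ∂(volume.restrict (Metric.ball 0 R)), u x = f ‖x‖) :
    LocallyIntegrableOn f (Ioo 0 R) := by
  have h1 : IntegrableOn (fun x : E N => f ‖x‖) (Metric.ball 0 R) := hu.congr hf
  rw [integrableOn_fun_norm_addHaar volume, finrank_euclideanSpace_fin] at h1
  have h2 : LocallyIntegrableOn (fun r => (r ^ (N - 1))⁻¹ * (r ^ (N - 1) • f r)) (Ioo 0 R) :=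
    h1.locallyIntegrableOn.continuousOn_mul (ContinuousOn.inv₀ (by fun_prop)
      fun r hr => pow_ne_zero _ hr.1.ne') isOpen_Ioo.isLocallyClosed
  intro r hr
  obtain ⟨s, hs, hs'⟩ := h2 r hr
  refine ⟨s ∩ Ioo 0 R, inter_mem hs self_mem_nhdsWithin, ?_⟩
  refine ((hs'.mono_set inter_subset_left).congr ?_)
  filter_upwards [ae_restrict_of_ae_restrict_of_subset inter_subset_right
    (ae_restrict_mem (measurableSet_Ioo (a := (0:ℝ)) (b := R)))] with t ht
  have : t ^ (N - 1) ≠ 0 := pow_ne_zero _ ht.1.ne'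
  simp [this]

/-- The spherical mean of the radial component of `Du`. -/
noncomputable def radialMean (R : ℝ) (Du : E N → E N) (r : ℝ) : ℝ :=
  sphereInt ((Metric.ball (0 : E N) R).indicator fun x => inner ℝ (Du x) x) r / (sphereArea N * r)

theorem locallyIntegrableOn_radialMean (hDu : IntegrableOn Du (Metric.ball 0 R)) :
    LocallyIntegrableOn (radialMean R Du) (Ioo 0 R) := by
  have h1 := (integrableOn_sphereInt (integrable_indicator_inner hDu)).locallyIntegrableOn
  have hA := (sphereArea_pos (N := N)).ne'
  have h2 := h1.continuousOn_mul (g := fun r => (r ^ (N - 1) * (sphereArea N * r))⁻¹)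
    (ContinuousOn.inv₀ (by fun_prop) fun r hr =>
      mul_ne_zero (pow_ne_zero _ (ne_of_gt hr)) (mul_ne_zero hA (ne_of_gt hr)))
    isOpen_Ioi.isLocallyClosed
  have h3 : LocallyIntegrableOn (radialMean R Du) (Ioi 0) := by
    intro r hr
    obtain ⟨s, hs, hs'⟩ := h2 r hr
    refine ⟨s ∩ Ioi 0, inter_mem hs self_mem_nhdsWithin, ?_⟩
    refine ((hs'.mono_set inter_subset_left).congr ?_)
    filter_upwards [ae_restrict_of_ae_restrict_of_subset inter_subset_right
      (ae_restrict_mem (measurableSet_Ioi (a := (0:ℝ))))] with t ht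
    have ht : t ≠ 0 := ne_of_gt ht
    simp only [radialMean]
    field_simp
  exact h3.mono_set Ioo_subset_Ioi_self

/-- Test the weak gradient with the field η(|x|) |x|^(-N) x. Its divergence is η'(|x|) |x|^(1-N), so
the polar weight cancels and a one-dimensional weak derivative remains. `Du` is not yet known to be
radial, hence the spherical mean. -/
theorem MemW01p.integral_mul_deriv_radial (h : MemW01p p (Metric.ball 0 R) u Du) (hp : 1 ≤ p)
    (hf : ∀ᵐ x ∂(volume.restrict (Metric.ball 0 R)), u x = f ‖x‖) {η : ℝ → ℝ}
    (hη : IsTest1 0 R η) :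
    ∫ r, f r * deriv η r = -∫ r, radialMean R Du r * η r := by
  have hp' : (1 : ENNReal) ≤ ENNReal.ofReal p := by simpa using hp
  have : IsFiniteMeasure (volume.restrict (Metric.ball (0 : E N) R)) :=
    ⟨by rw [Measure.restrict_apply_univ]; exact measure_ball_lt_top⟩
  have hu : Integrable u (volume.restrict (Metric.ball 0 R)) := h.memLp.integrable hp'
  have hDu : Integrable Du (volume.restrict (Metric.ball 0 R)) := h.memLp_grad.integrable hp'
  have hA := sphereArea_pos (N := N)
  -- The power N is the one for which the terms without η' cancel in k' r + N k.
  set k : ℝ → ℝ := fun r => η r * (r ^ N)⁻¹ with hkdef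
  have hk : IsTest1 0 R k := hη.mul_inv_pow N
  have hk1 : Differentiable ℝ k := hk.smooth.differentiable (by simp)
  set ψ : Fin N → E N → ℝ := fun i x => k ‖x‖ * x i
  have hcoord : ∀ i, ContDiff ℝ 1 fun x : E N => x i := fun i =>
    (EuclideanSpace.proj (𝕜 := ℝ) i : E N →L[ℝ] ℝ).contDiff
  have hψ : ∀ i, ContDiff ℝ 1 (ψ i) := fun i =>
    (hk.radial.smooth.of_le (by simp)).mul (hcoord i)
  have hψc : ∀ i, HasCompactSupport (ψ i) := fun i => hk.radial.compact.mul_right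
  have hip : ∀ i, ∫ x in Metric.ball 0 R, u x * fderiv ℝ (ψ i) x (EuclideanSpace.single i 1) =
      -∫ x in Metric.ball 0 R, inner ℝ (Du x) (EuclideanSpace.single i 1) * ψ i x := fun i =>
    h.integral_mul_fderiv hp (hψ i) (hψc i) _
  have hsum := Finset.sum_congr (rfl : (Finset.univ : Finset (Fin N)) = Finset.univ)
    fun i _ => hip i
  rw [Finset.sum_neg_distrib, ← integral_finsetSum, ← integral_finsetSum] at hsum
  rotate_left
  · intro i _
    obtain ⟨K, hK⟩ := (hψ i).continuous.bounded_above_of_compact_support (hψc i)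
    exact (hDu.inner_const _).mul_bdd (hψ i).continuous.aestronglyMeasurable
      (Eventually.of_forall hK)
  · intro i _
    have c2 : Continuous fun x => fderiv ℝ (ψ i) x (EuclideanSpace.single i 1) :=
      ((hψ i).continuous_fderiv one_ne_zero).clm_apply continuous_const
    obtain ⟨K, hK⟩ := c2.bounded_above_of_compact_support ((hψc i).fderiv_apply (𝕜 := ℝ) _)
    exact hu.mul_bdd c2.aestronglyMeasurable (Eventually.of_forall hK)
  have hne : ∀ᵐ x : E N, x ≠ 0 := by simp [ae_iff]
  have hdk : ∀ r, 0 < r → deriv k r * r + N * k r = deriv η r * (r * (r ^ N)⁻¹) := by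
    intro r hr
    have h1 : HasDerivAt k (deriv η r * (r ^ N)⁻¹ + η r * (-(N * r ^ (N - 1)) / (r ^ N) ^ 2)) r :=
      ((hη.smooth.differentiable (by simp)) r).hasDerivAt.mul
        ((hasDerivAt_pow N r).inv (pow_ne_zero N hr.ne'))
    rw [h1.deriv]
    have hN : N ≠ 0 := by
      rintro rfl
      simp [sphereArea] at hA
    have h2 : r ^ N = r ^ (N - 1) * r := (pow_sub_one_mul hN r).symm
    simp only [hkdef]
    rw [h2]
    field_simp
    ring
  have hL : ∫ x in Metric.ball (0 : E N) R,
      ∑ i, u x * fderiv ℝ (ψ i) x (EuclideanSpace.single i 1) =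
      sphereArea N * ∫ r, f r * deriv η r := by
    have e1 : ∫ x in Metric.ball (0 : E N) R,
        ∑ i, u x * fderiv ℝ (ψ i) x (EuclideanSpace.single i 1) =
        ∫ x in Metric.ball (0 : E N) R, f ‖x‖ * (deriv η ‖x‖ * (‖x‖ * (‖x‖ ^ N)⁻¹)) := by
      refine integral_congr_ae ?_
      filter_upwards [hf, ae_restrict_of_ae hne] with x hx hx0
      have hn : 0 < ‖x‖ := norm_pos_iff.2 hx0
      rw [← hdk _ hn, ← hx, ← Finset.mul_sum]
      congr 1
      rw [Finset.sum_congr rfl fun i _ => fderiv_radial_mul_coord hk1 hx0 i,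
        Finset.sum_add_distrib, ← Finset.mul_sum]
      have : ∑ i, x i ^ 2 = ‖x‖ ^ 2 := (EuclideanSpace.real_norm_sq_eq x).symm
      rw [this]
      simp
      field_simp
    rw [e1, setIntegral_eq_integral_of_forall_compl_eq_zero,
      integral_radial fun r => f r * (deriv η r * (r * (r ^ N)⁻¹))]
    · rw [← integral_Ioi_eq_of_isTest1 hη.deriv]
      congr 1
      refine setIntegral_congr_fun measurableSet_Ioi fun r (hr : 0 < r) => ?_
      have hN : N ≠ 0 := by
        rintro rfl
        simp [sphereArea] at hA
      have h2 : r ^ N = r ^ (N - 1) * r := (pow_sub_one_mul hN r).symm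
      simp only [h2]
      field_simp
    · intro x hx
      rw [image_eq_zero_of_notMem_tsupport (f := deriv η) fun h' => hx (by
        simpa using (hη.deriv.supp h').2)]
      simp
  have hRR : ∫ x in Metric.ball (0 : E N) R,
      ∑ i, inner ℝ (Du x) (EuclideanSpace.single i 1) * ψ i x =
      sphereArea N * ∫ r, radialMean R Du r * η r := by
    set F := (Metric.ball (0 : E N) R).indicator fun x => inner ℝ (Du x) x with hFdef
    have hF : Integrable F := integrable_indicator_inner hDu
    have e1 : ∫ x in Metric.ball (0 : E N) R,
        ∑ i, inner ℝ (Du x) (EuclideanSpace.single i 1) * ψ i x = ∫ x, F x * k ‖x‖ := by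
      rw [← integral_indicator measurableSet_ball]
      congr 1
      funext x
      by_cases hx : x ∈ Metric.ball (0 : E N) R
      · rw [indicator_of_mem hx, hFdef, indicator_of_mem hx]
        have : inner ℝ (Du x) x = ∑ i, Du x i * x i := by
          simp [PiLp.inner_apply, mul_comm]
        rw [this, Finset.sum_mul]
        refine Finset.sum_congr rfl fun i _ => ?_
        simp only [ψ, EuclideanSpace.inner_single_right, conj_trivial]
        ring
      · rw [indicator_of_notMem hx, hFdef, indicator_of_notMem hx, zero_mul]
    have hFk : Integrable fun x => F x * k ‖x‖ := by
      obtain ⟨K, hK⟩ := hk.radial.smooth.continuous.bounded_above_of_compact_support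
        (hk.radial (N := N)).compact
      exact hF.mul_bdd (hk.radial.smooth.continuous.aestronglyMeasurable)
        (Eventually.of_forall hK)
    rw [e1, integral_eq_sphereInt hFk, ← integral_Ioi_eq_of_isTest1 hη, ← integral_const_mul]
    refine setIntegral_congr_fun measurableSet_Ioi fun r (hr : 0 < r) => ?_
    change r ^ (N - 1) * sphereInt (fun x => F x * k ‖x‖) r =
      sphereArea N * (radialMean R Du r * η r)
    rw [sphereInt_mul_radial F k hr]
    simp only [radialMean, hkdef]
    have hN : N ≠ 0 := by
      rintro rfl
      simp [sphereArea] at hA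
    have h2 : r ^ N = r ^ (N - 1) * r := (pow_sub_one_mul hN r).symm
    rw [h2]
    field_simp
    rw [mul_comm]
  rw [hL, hRR, ← mul_neg] at hsum
  exact mul_left_cancel₀ hA.ne' hsum

end RadialWeakGradient

/-! ### The weak gradient of a radial function is radial -/

section RadialPrimitive
open Set
variable {N : ℕ} [Nontrivial (E N)] {p R : ℝ} {u : E N → ℝ} {Du : E N → E N} {f w : ℝ → ℝ}

theorem isOpen_puncturedBall {N : ℕ} (R : ℝ) : IsOpen (Metric.ball (0 : E N) R \ {0}) :=
  Metric.isOpen_ball.sdiff isClosed_singleton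

theorem norm_mem_Ioo {N : ℕ} {R : ℝ} {x : E N} (hx : x ∈ Metric.ball (0 : E N) R \ {0}) :
    ‖x‖ ∈ Ioo 0 R := ⟨norm_pos_iff.2 hx.2, by simpa using hx.1⟩

theorem continuousOn_radial {N : ℕ} {R : ℝ} {U : ℝ → ℝ} (hU : ContinuousOn U (Ioo 0 R)) :
    ContinuousOn (fun x : E N => U ‖x‖) (Metric.ball 0 R \ {0}) :=
  hU.comp continuous_norm.continuousOn fun _ hx => norm_mem_Ioo hx

theorem integral_radial_mul_fderiv {N : ℕ} {U U' : ℝ → ℝ} (hU : ∀ r, HasDerivAt U (U' r) r)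
    (hU' : Continuous U') {ψ : E N → ℝ} (hψ : ContDiff ℝ 1 ψ) (hc : HasCompactSupport ψ)
    (hs : tsupport ψ ⊆ {0}ᶜ) (e : E N) :
    ∫ x, U ‖x‖ * fderiv ℝ ψ x e = -∫ x, (U' ‖x‖ * ‖x‖⁻¹ * inner ℝ x e) * ψ x := by
  have hUc : Continuous U := continuous_iff_continuousAt.2 fun r => (hU r).continuousAt
  have c2 : Continuous fun x => fderiv ℝ ψ x e :=
    (hψ.continuous_fderiv one_ne_zero).clm_apply continuous_const
  have hc2 : HasCompactSupport fun x => fderiv ℝ ψ x e := hc.fderiv_apply (𝕜 := ℝ) e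
  have hcU : Continuous fun x : E N => U ‖x‖ := hUc.comp continuous_norm
  have hd : ∀ x ∈ tsupport ψ, HasFDerivAt (fun x : E N => U ‖x‖)
      ((U' ‖x‖ * ‖x‖⁻¹) • innerSL ℝ x) x := fun x hx => hasFDerivAt_radial (hs hx) (hU _)
  have hco : ContinuousOn (fun x : E N => U' ‖x‖ * ‖x‖⁻¹ * inner ℝ x e) {0}ᶜ :=
    (((hU'.comp continuous_norm).continuousOn).mul (continuous_norm.continuousOn.inv₀
      fun x hx => norm_ne_zero_iff.2 hx)).mul (by fun_prop)
  have key := integral_bilinear_hasFDerivAt_right_eq_neg_left_of_integrable (μ := volume)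
    (B := ContinuousLinearMap.mul ℝ ℝ) (f := fun x : E N => U ‖x‖) (g := ψ) (v := e)
    (f' := fun x => (U' ‖x‖ * ‖x‖⁻¹) • innerSL ℝ x) (g' := fun x => fderiv ℝ ψ x)
    ?_ ?_ ?_ hd (fun x _ => (hψ.differentiable one_ne_zero x).hasFDerivAt)
  · simpa using key
  · have := integrable_mul_of_tsupport_subset
      (hco.locallyIntegrableOn (μ := volume) isOpen_compl_singleton.measurableSet)
      hψ.continuous hc hs
    simpa using this
  · exact (hcU.mul c2).integrable_of_hasCompactSupport hc2.mul_left
  · exact (hcU.mul hψ.continuous).integrable_of_hasCompactSupport hc.mul_left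

/-- The radial primitive of w has weak gradient w(|x|) x/|x| away from the origin. For continuous w
this is the classical formula; in general w is approximated in L¹ on a compact interval of radii,
and both sides change by a multiple of ε. -/
theorem integral_radial_primitive_mul_fderiv (hw : LocallyIntegrableOn w (Ioo 0 R)) {r₀ : ℝ}
    (hr : r₀ ∈ Ioo 0 R) (c : ℝ) {ψ : E N → ℝ} (hψ : ContDiff ℝ 1 ψ) (hc : HasCompactSupport ψ)
    (hs : tsupport ψ ⊆ Metric.ball 0 R \ {0}) (e : E N) :
    ∫ x, (c + ∫ t in r₀..‖x‖, w t) * fderiv ℝ ψ x e =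
      -∫ x, (w ‖x‖ * ‖x‖⁻¹ * inner ℝ x e) * ψ x := by
  have hopen := isOpen_puncturedBall (N := N) R
  have c2 : Continuous fun x => fderiv ℝ ψ x e :=
    (hψ.continuous_fderiv one_ne_zero).clm_apply continuous_const
  have hc2 : HasCompactSupport fun x => fderiv ℝ ψ x e := hc.fderiv_apply (𝕜 := ℝ) e
  have hs2 : tsupport (fun x => fderiv ℝ ψ x e) ⊆ tsupport ψ := tsupport_fderiv_apply_subset ℝ e
  obtain ⟨K, hK⟩ := hψ.continuous.bounded_above_of_compact_support hc
  obtain ⟨a, b, ha, har, hrb, hb, hab, hKab⟩ := exists_Icc_of_isCompact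
    (hc.isCompact.image continuous_norm) (α := 0) (β := R) (by
      rintro _ ⟨x, hx, rfl⟩
      exact norm_mem_Ioo (hs hx)) hr
  have hwab : IntegrableOn w (Icc a b) :=
    hw.integrableOn_compact_subset (Icc_subset_Ioo ha hb) isCompact_Icc
  -- `M` controls the change of the primitive and `M'` that of w itself, where b^(N-1) bounds the
  -- polar weight on the support of ψ.
  set M := ∫ x, ‖fderiv ℝ ψ x e‖
  set M' := ‖e‖ * K * (sphereArea N * b ^ (N - 1))
  have hmain : ∀ ε > 0, |(∫ x, (c + ∫ t in r₀..‖x‖, w t) * fderiv ℝ ψ x e) +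
      ∫ x, (w ‖x‖ * ‖x‖⁻¹ * inner ℝ x e) * ψ x| ≤ (M + M') * ε := by
    intro ε hε
    obtain ⟨w', -, hw'ε, hw'c, hw'i⟩ := Integrable.exists_hasCompactSupport_integral_sub_le hwab hε
    have hU' : ∀ r, HasDerivAt (fun r => c + ∫ t in r₀..r, w' t) (w' r) r := fun r =>
      ((hw'c.integral_hasStrictDerivAt r₀ r).hasDerivAt).const_add c
    have hUc' : Continuous (fun r => c + ∫ t in r₀..r, w' t) :=
      continuous_iff_continuousAt.2 fun r => (hU' r).continuousAt
    have hid := integral_radial_mul_fderiv hU' hw'c hψ hc (fun x hx => (hs hx).2) e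
    have hcU : ContinuousOn (fun r => c + ∫ t in r₀..r, w t) (Ioo 0 R) :=
      continuousOn_const.add (continuousOn_primitive_of_mem hw hr)
    have i1 : Integrable fun x : E N => (c + ∫ t in r₀..‖x‖, w t) * fderiv ℝ ψ x e :=
      integrable_mul_of_tsupport_subset ((continuousOn_radial hcU).locallyIntegrableOn
        hopen.measurableSet) c2 hc2 (hs2.trans hs)
    have i2 : Integrable fun x : E N => (c + ∫ t in r₀..‖x‖, w' t) * fderiv ℝ ψ x e :=
      ((hUc'.comp continuous_norm).mul c2).integrable_of_hasCompactSupport hc2.mul_left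
    have hcq : ContinuousOn (fun x : E N => ‖x‖⁻¹ * inner ℝ x e) (Metric.ball 0 R \ {0}) :=
      (continuous_norm.continuousOn.inv₀ fun x hx => norm_ne_zero_iff.2 hx.2).mul (by fun_prop)
    have hli : ∀ g : ℝ → ℝ, LocallyIntegrableOn g (Ioo 0 R) →
        Integrable fun x : E N => (g ‖x‖ * ‖x‖⁻¹ * inner ℝ x e) * ψ x := by
      intro g hg
      have h1 := (locallyIntegrableOn_radial (N := N) hg).mul_continuousOn hcq hopen.isLocallyClosed
      have h2 := integrable_mul_of_tsupport_subset h1 hψ.continuous hc hs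
      refine h2.congr (Eventually.of_forall fun x => ?_)
      dsimp only; ring
    have j1 := hli w hw
    have j2 := hli w' (hw'c.locallyIntegrable.locallyIntegrableOn _)
    have hsub : (∫ x, (c + ∫ t in r₀..‖x‖, w t) * fderiv ℝ ψ x e) +
        ∫ x, (w ‖x‖ * ‖x‖⁻¹ * inner ℝ x e) * ψ x =
        (∫ x, ((c + ∫ t in r₀..‖x‖, w t) * fderiv ℝ ψ x e -
          (c + ∫ t in r₀..‖x‖, w' t) * fderiv ℝ ψ x e)) +
        ∫ x, ((w ‖x‖ * ‖x‖⁻¹ * inner ℝ x e) * ψ x - (w' ‖x‖ * ‖x‖⁻¹ * inner ℝ x e) * ψ x) := by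
      rw [integral_sub i1 i2, integral_sub j1 j2, hid]; ring
    have hww' : IntegrableOn (fun t => w t - w' t) (Icc a b) := hwab.sub hw'i
    have b1 : |∫ x, ((c + ∫ t in r₀..‖x‖, w t) * fderiv ℝ ψ x e -
        (c + ∫ t in r₀..‖x‖, w' t) * fderiv ℝ ψ x e)| ≤ M * ε := by
      rw [← Real.norm_eq_abs, ← integral_mul_const]
      refine norm_integral_le_of_norm_le
        ((c2.norm.integrable_of_hasCompactSupport hc2.norm).mul_const ε)
        (Eventually.of_forall fun x => ?_)
      by_cases hx : x ∈ tsupport ψ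
      · rw [← sub_mul, add_sub_add_left_eq_sub, norm_mul, mul_comm]
        refine mul_le_mul_of_nonneg_left ?_ (norm_nonneg _)
        have hxab := hKab (mem_image_of_mem norm hx)
        have hsubset : uIoc r₀ ‖x‖ ⊆ Icc a b := uIoc_subset_uIcc.trans
          (ordConnected_Icc.uIcc_subset ⟨har, hrb⟩ (Ioo_subset_Icc_self hxab))
        rw [← intervalIntegral.integral_sub
          (intervalIntegrable_iff.2 (hwab.mono_set hsubset))
          (hw'c.intervalIntegrable _ _)]
        refine (intervalIntegral.norm_integral_le_integral_norm_uIoc).trans ?_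
        exact (setIntegral_mono_set hww'.norm (Eventually.of_forall fun _ => norm_nonneg _)
          hsubset.eventuallyLE).trans hw'ε
      · have : fderiv ℝ ψ x e = 0 := by
          rw [image_eq_zero_of_notMem_tsupport fun h => hx (tsupport_fderiv_subset ℝ h)]; rfl
        simp [this]
    have b2 : |∫ x, ((w ‖x‖ * ‖x‖⁻¹ * inner ℝ x e) * ψ x -
        (w' ‖x‖ * ‖x‖⁻¹ * inner ℝ x e) * ψ x)| ≤ M' * ε := by
      set g : ℝ → ℝ := (Icc a b).indicator fun t => ‖w t - w' t‖ with hg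
      have hgi : Integrable g := (integrable_indicator_iff measurableSet_Icc).2 hww'.norm
      have hgm : ∀ r ∈ Ioi (0 : ℝ), r ^ (N - 1) * g r ≤ b ^ (N - 1) * g r := by
        intro r hr
        by_cases hrab : r ∈ Icc a b
        · exact mul_le_mul_of_nonneg_right (pow_le_pow_left₀ (le_of_lt hr) hrab.2 _)
            (indicator_nonneg (fun _ _ => norm_nonneg _) _)
        · simp [hg, hrab]
      have hgr : IntegrableOn (fun r => r ^ (N - 1) * g r) (Ioi 0) := by
        refine Integrable.mono' ((hgi.const_mul (b ^ (N - 1))).integrableOn)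
          ((by fun_prop : Continuous fun r : ℝ => r ^ (N - 1)).aestronglyMeasurable.mul
            hgi.aestronglyMeasurable.restrict) ?_
        filter_upwards [ae_restrict_mem measurableSet_Ioi] with r hr
        rw [Real.norm_of_nonneg (mul_nonneg (pow_nonneg (le_of_lt hr) _)
          (indicator_nonneg (fun _ _ => norm_nonneg _) _))]
        exact hgm r hr
      have hgx : Integrable fun x : E N => g ‖x‖ := by
        rw [integrable_fun_norm_addHaar volume (f := g), finrank_euclideanSpace_fin]
        exact hgr
      have hint : ∫ x : E N, g ‖x‖ ≤ sphereArea N * b ^ (N - 1) * ε := by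
        rw [integral_radial, mul_assoc]
        refine mul_le_mul_of_nonneg_left ?_ sphereArea_pos.le
        calc ∫ r in Ioi (0 : ℝ), r ^ (N - 1) * g r
            ≤ ∫ r in Ioi (0 : ℝ), b ^ (N - 1) * g r :=
              setIntegral_mono_on hgr (hgi.const_mul _).integrableOn measurableSet_Ioi hgm
          _ ≤ ∫ r, b ^ (N - 1) * g r := setIntegral_le_integral (hgi.const_mul _)
              (Eventually.of_forall fun r => mul_nonneg (pow_nonneg (by linarith) _)
                (indicator_nonneg (fun _ _ => norm_nonneg _) _))
          _ = b ^ (N - 1) * ∫ t in Icc a b, ‖w t - w' t‖ := by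
              rw [integral_const_mul, hg, integral_indicator measurableSet_Icc]
          _ ≤ _ := mul_le_mul_of_nonneg_left hw'ε (pow_nonneg (by linarith) _)
      have hKnn : 0 ≤ K := (norm_nonneg _).trans (hK 0)
      have hfin : ‖e‖ * K * ∫ x : E N, g ‖x‖ ≤ M' * ε := by
        calc _ ≤ ‖e‖ * K * (sphereArea N * b ^ (N - 1) * ε) :=
              mul_le_mul_of_nonneg_left hint (by positivity)
          _ = _ := by simp only [M']; ring
      refine le_trans ?_ hfin
      rw [← Real.norm_eq_abs, ← integral_const_mul]
      refine norm_integral_le_of_norm_le (hgx.const_mul _) (Eventually.of_forall fun x => ?_)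
      by_cases hx : x ∈ tsupport ψ
      · have hxab := Ioo_subset_Icc_self (hKab (mem_image_of_mem norm hx))
        have hn : 0 < ‖x‖ := (norm_mem_Ioo (hs hx)).1
        have e1 : (w ‖x‖ * ‖x‖⁻¹ * inner ℝ x e) * ψ x - (w' ‖x‖ * ‖x‖⁻¹ * inner ℝ x e) * ψ x =
            (‖x‖⁻¹ * inner ℝ x e) * ψ x * (w ‖x‖ - w' ‖x‖) := by ring
        rw [e1, norm_mul, hg, indicator_of_mem hxab, norm_mul]
        refine mul_le_mul_of_nonneg_right ?_ (norm_nonneg _)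
        refine mul_le_mul ?_ (hK x) (norm_nonneg _) (norm_nonneg _)
        rw [norm_mul, norm_inv, norm_norm, inv_mul_le_iff₀ hn]
        exact norm_inner_le_norm _ _
      · rw [image_eq_zero_of_notMem_tsupport hx]
        simp only [mul_zero, sub_zero, norm_zero]
        exact mul_nonneg (by positivity) (indicator_nonneg (fun _ _ => norm_nonneg _) _)
    rw [hsub]
    calc _ ≤ _ := abs_add_le _ _
      _ ≤ M * ε + M' * ε := add_le_add b1 b2
      _ = _ := by ring
  have hzero : (∫ x, (c + ∫ t in r₀..‖x‖, w t) * fderiv ℝ ψ x e) +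
      ∫ x, (w ‖x‖ * ‖x‖⁻¹ * inner ℝ x e) * ψ x = 0 := by
    rw [← abs_nonpos_iff]
    have ht : Tendsto (fun ε : ℝ => (M + M') * ε) (𝓝[>] 0) (𝓝 0) := by
      have : Tendsto (fun ε : ℝ => (M + M') * ε) (𝓝 0) (𝓝 ((M + M') * 0)) :=
        (continuous_const.mul continuous_id).tendsto 0
      rw [mul_zero] at this
      exact this.mono_left nhdsWithin_le_nhds
    exact ge_of_tendsto ht (by filter_upwards [self_mem_nhdsWithin] with ε hε using hmain ε hε)
  linarith

/-- A radial function in `W₀^{1,p}` of a ball is a primitive of its radial weak derivative. -/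
theorem MemW01p.exists_radial_primitive (hR : 0 < R) (h : MemW01p p (Metric.ball 0 R) u Du)
    (hp : 1 ≤ p) (hf : ∀ᵐ x ∂(volume.restrict (Metric.ball 0 R)), u x = f ‖x‖) :
    ∃ (w : ℝ → ℝ) (c : ℝ), LocallyIntegrableOn w (Ioo 0 R) ∧
      (∀ᵐ x ∂(volume.restrict (Metric.ball 0 R)), u x = c + ∫ t in (R / 2)..‖x‖, w t) ∧
      (∀ᵐ x ∂(volume.restrict (Metric.ball 0 R)), Du x = (w ‖x‖ * ‖x‖⁻¹) • x) := by
  have hp' : (1 : ENNReal) ≤ ENNReal.ofReal p := by simpa using hp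
  have : IsFiniteMeasure (volume.restrict (Metric.ball (0 : E N) R)) :=
    ⟨by rw [Measure.restrict_apply_univ]; exact measure_ball_lt_top⟩
  have hu : Integrable u (volume.restrict (Metric.ball 0 R)) := h.memLp.integrable hp'
  have hDu : Integrable Du (volume.restrict (Metric.ball 0 R)) := h.memLp_grad.integrable hp'
  have hw := locallyIntegrableOn_radialMean (N := N) (R := R) hDu
  have hr : R / 2 ∈ Ioo 0 R := ⟨by linarith, by linarith⟩
  obtain ⟨c, hc⟩ := ae_eq_primitive_of_weak_deriv hR (locallyIntegrableOn_of_radial hu hf) hw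
    (fun η hη => h.integral_mul_deriv_radial hp hf hη) hr
  set w := radialMean R Du
  have hu' : ∀ᵐ x ∂(volume.restrict (Metric.ball 0 R)), u x = c + ∫ t in (R / 2)..‖x‖, w t := by
    filter_upwards [hf, ae_restrict_of_ae (ae_norm_of_ae (N := N) hc),
      ae_restrict_mem measurableSet_ball] with x h1 h2 h3
    rw [h1, h2 h3]
  refine ⟨w, c, hw, hu', ?_⟩
  have hopen := isOpen_puncturedBall (N := N) R
  have hcq : ContinuousOn (fun x : E N => ‖x‖⁻¹ • x) (Metric.ball 0 R \ {0}) :=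
    (continuous_norm.continuousOn.inv₀ fun x hx => norm_ne_zero_iff.2 hx.2).smul continuousOn_id
  have hl1 : LocallyIntegrableOn (fun x : E N => (w ‖x‖ * ‖x‖⁻¹) • x) (Metric.ball 0 R \ {0}) := by
    have := (locallyIntegrableOn_radial (N := N) hw).smul_continuousOn hopen.isLocallyClosed hcq
    simpa only [smul_smul] using this
  have hl2 : LocallyIntegrableOn Du (Metric.ball 0 R \ {0}) :=
    (IntegrableOn.locallyIntegrableOn (s := Metric.ball 0 R) hDu).mono_set sdiff_subset
  -- `Du` and w(|x|) x/|x| are both weak gradients of u on the punctured ball, so they agree there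
  -- almost everywhere; the difference is tested component by component against a vector e.
  have hz := hopen.ae_eq_zero_of_integral_contDiff_smul_eq_zero (hl2.sub hl1) (fun ψ hψ hψc hψs => by
    have k1 : Integrable fun x => ψ x • Du x :=
      integrable_smul_of_tsupport_subset hl2 hψ.continuous hψc hψs
    have k2 : Integrable fun x => ψ x • ((w ‖x‖ * ‖x‖⁻¹) • x) :=
      integrable_smul_of_tsupport_subset hl1 hψ.continuous hψc hψs
    have hψ1 : ContDiff ℝ 1 ψ := hψ.of_le (by simp)
    simp only [Pi.sub_apply, smul_sub]
    rw [integral_sub k1 k2, sub_eq_zero]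
    refine ext_inner_right ℝ fun e => ?_
    have g1 : inner ℝ (∫ x, ψ x • Du x) e = ∫ x in Metric.ball 0 R, inner ℝ (Du x) e * ψ x := by
      rw [real_inner_comm, ← integral_inner k1, setIntegral_eq_integral_of_forall_compl_eq_zero]
      · refine integral_congr_ae (Eventually.of_forall fun x => ?_)
        simp only [inner_smul_right]
        rw [real_inner_comm]; ring
      · intro x hx
        rw [image_eq_zero_of_notMem_tsupport fun h' => hx (hψs h').1, mul_zero]
    have g2 : inner ℝ (∫ x, ψ x • ((w ‖x‖ * ‖x‖⁻¹) • x)) e =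
        ∫ x, (w ‖x‖ * ‖x‖⁻¹ * inner ℝ x e) * ψ x := by
      rw [real_inner_comm, ← integral_inner k2]
      refine integral_congr_ae (Eventually.of_forall fun x => ?_)
      simp only [inner_smul_right]
      rw [real_inner_comm]; ring
    rw [g1, g2]
    have q1 := h.integral_mul_fderiv hp hψ1 hψc e
    have q2 := integral_radial_primitive_mul_fderiv hw hr c hψ1 hψc hψs e
    have q3 : ∫ x in Metric.ball 0 R, u x * fderiv ℝ ψ x e =
        ∫ x, (c + ∫ t in (R / 2)..‖x‖, w t) * fderiv ℝ ψ x e := by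
      refine Eq.trans ?_ (setIntegral_eq_integral_of_forall_compl_eq_zero
        (s := Metric.ball (0 : E N) R) ?_)
      · refine integral_congr_ae ?_
        filter_upwards [hu'] with x hx
        rw [hx]
      · intro x hx
        have : fderiv ℝ ψ x = 0 := image_eq_zero_of_notMem_tsupport fun h' =>
          hx (hψs (tsupport_fderiv_subset ℝ h')).1
        simp [this]
    linarith)
  have hne : ∀ᵐ x : E N, x ≠ 0 := by simp [ae_iff]
  filter_upwards [ae_restrict_of_ae hz, ae_restrict_of_ae hne,
    ae_restrict_mem measurableSet_ball] with x h1 h2 h3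
  have := h1 ⟨h3, h2⟩
  simpa [sub_eq_zero] using this

end RadialPrimitive

/-! ### The radial differential equation -/

section RadialEquation
open Set
variable {N : ℕ} {p μ s lam R : ℝ} {u : E N → ℝ} {Du : E N → E N}

/-- A finite energy `C¹` solution `U`, with derivative `V`, of the radial equation on `(0, R)`. -/
structure IsRadialSolution (N : ℕ) (p μ s lam R : ℝ) (U V : ℝ → ℝ) : Prop where
  hasDerivAt : ∀ r ∈ Ioo 0 R, HasDerivAt U (V r) r
  continuousOn : ContinuousOn V (Ioo 0 R)
  flux : ∀ r ∈ Ioo 0 R, HasDerivAt (fun r => r ^ (N - 1) * oddPow p (V r))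
    (-(r ^ (N - 1) * ((μ / r ^ p + lam) * oddPow p (U r) + oddPow (pstar N p s) (U r) / r ^ s))) r
  energy : IntegrableOn (fun r => r ^ (N - 1) * |V r| ^ p) (Ioo 0 R)

theorem lt_pstar (hp : 1 < p) (hpN : p < N) (hsp : s < p) : p < pstar N p s := by
  unfold pstar
  rw [lt_div_iff₀ (by linarith)]
  nlinarith

theorem gradient_radial {η : ℝ → ℝ} {η' : ℝ} {x : E N} (hη : HasDerivAt η η' ‖x‖) (hx : x ≠ 0) :
    gradient (fun x : E N => η ‖x‖) x = (η' * ‖x‖⁻¹) • x := by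
  refine HasGradientAt.gradient ?_
  rw [hasGradientAt_iff_hasFDerivAt]
  refine (hasFDerivAt_radial hx hη).congr_fderiv ?_
  ext y
  simp

theorem hasDerivAt_primitive_of_continuousOn {g : ℝ → ℝ} (hg : ContinuousOn g (Ioo 0 R))
    {r₀ r : ℝ} (hr₀ : r₀ ∈ Ioo 0 R) (hr : r ∈ Ioo 0 R) :
    HasDerivAt (fun r => ∫ t in r₀..r, g t) (g r) r :=
  intervalIntegral.integral_hasDerivAt_right
    (intervalIntegrable_of_locallyIntegrableOn
      (hg.locallyIntegrableOn measurableSet_Ioo) hr₀ hr)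
    (hg.stronglyMeasurableAtFilter isOpen_Ioo r hr) (hg.continuousAt (isOpen_Ioo.mem_nhds hr))

/-- Finite energy controls the flux through |w|^(p-1) ≤ 1 + |w|^p. -/
theorem locallyIntegrableOn_flux {w : ℝ → ℝ} (hp : 1 < p)
    (hw : LocallyIntegrableOn w (Ioo 0 R))
    (hen : IntegrableOn (fun r => r ^ (N - 1) * |w r| ^ p) (Ioo 0 R)) :
    LocallyIntegrableOn (fun r => r ^ (N - 1) * oddPow p (w r)) (Ioo 0 R) := by
  rw [locallyIntegrableOn_iff isOpen_Ioo.isLocallyClosed] at hw ⊢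
  intro k hk hkc
  have hpow : Continuous fun r : ℝ => r ^ (N - 1) := by fun_prop
  refine Integrable.mono' (g := fun r => r ^ (N - 1) + r ^ (N - 1) * |w r| ^ p)
    ((hpow.continuousOn.integrableOn_compact hkc).add (hen.mono_set hk)) ?_ ?_
  · exact hpow.aestronglyMeasurable.mul
      ((continuous_oddPow hp).comp_aestronglyMeasurable (hw k hk hkc).aestronglyMeasurable)
  · filter_upwards [ae_restrict_mem hkc.measurableSet] with r hr
    have hr0 : 0 < r := (hk hr).1
    rw [norm_mul, Real.norm_of_nonneg (by positivity), Real.norm_eq_abs, abs_oddPow hp]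
    have : |w r| ^ (p - 1) ≤ 1 + |w r| ^ p := by
      rcases le_total |w r| 1 with h | h
      · have := Real.rpow_le_one (abs_nonneg (w r)) h (by linarith : 0 ≤ p - 1)
        have : 0 ≤ |w r| ^ p := by positivity
        linarith
      · have := Real.rpow_le_rpow_of_exponent_le h (by linarith : p - 1 ≤ p)
        linarith
    nlinarith [pow_pos hr0 (N - 1)]

variable [Nontrivial (E N)]

theorem integrableOn_energy {w : ℝ → ℝ} (hp : 1 < p)
    (hmem : MemLp Du (ENNReal.ofReal p) (volume.restrict (Metric.ball 0 R)))
    (hDu : ∀ᵐ x ∂(volume.restrict (Metric.ball (0 : E N) R)), Du x = (w ‖x‖ * ‖x‖⁻¹) • x) :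
    IntegrableOn (fun r => r ^ (N - 1) * |w r| ^ p) (Ioo 0 R) := by
  have h1 := hmem.integrable_norm_rpow (by simp; linarith) ENNReal.ofReal_ne_top
  rw [ENNReal.toReal_ofReal (by linarith)] at h1
  have hne : ∀ᵐ x : E N, x ≠ 0 := by simp [ae_iff]
  have h2 : IntegrableOn (fun x : E N => |w ‖x‖| ^ p) (Metric.ball 0 R) := by
    refine h1.congr ?_
    filter_upwards [hDu, ae_restrict_of_ae hne] with x hx hx0
    have : ‖x‖ ≠ 0 := norm_ne_zero_iff.2 hx0
    rw [hx, norm_smul, norm_mul, norm_inv, norm_norm, mul_assoc, inv_mul_cancel₀ this, mul_one,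
      Real.norm_eq_abs]
  rw [integrableOn_fun_norm_addHaar volume (f := fun r => |w r| ^ p),
    finrank_euclideanSpace_fin] at h2
  exact h2

/-- The weak formulation for the test function η(|x|), in polar coordinates. It is the hypothesis of
the du Bois-Reymond lemma for the flux; since η vanishes near 0, the singular coefficients are
harmless. -/
theorem IsWeakSolution.integral_flux_mul_deriv {w U : ℝ → ℝ} (hp : 1 < p) (hpN : p < N)
    (hsp : s < p) (h : IsWeakSolution p μ s lam (Metric.ball 0 R) u Du)
    (hu : ∀ᵐ x ∂(volume.restrict (Metric.ball (0 : E N) R)), u x = U ‖x‖)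
    (hDu : ∀ᵐ x ∂(volume.restrict (Metric.ball (0 : E N) R)), Du x = (w ‖x‖ * ‖x‖⁻¹) • x)
    (hw : LocallyIntegrableOn (fun r => r ^ (N - 1) * oddPow p (w r)) (Ioo 0 R))
    (hU : ContinuousOn U (Ioo 0 R)) {η : ℝ → ℝ} (hη : IsTest1 0 R η) :
    ∫ r, (r ^ (N - 1) * oddPow p (w r)) * deriv η r =
      -∫ r, -(r ^ (N - 1) * ((μ / r ^ p + lam) * oddPow p (U r) +
        oddPow (pstar N p s) (U r) / r ^ s)) * η r := by
  have hps := lt_pstar hp hpN hsp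
  have hne : ∀ᵐ x : E N, x ≠ 0 := by simp [ae_iff]
  have heq := h.eq _ (hη.radial (N := N))
  have e1 : ∫ x in Metric.ball (0 : E N) R, (‖Du x‖ ^ (p - 2) *
        inner ℝ (Du x) (gradient (fun x : E N => η ‖x‖) x)
        - μ / ‖x‖ ^ p * |u x| ^ (p - 2) * u x * η ‖x‖
        - lam * |u x| ^ (p - 2) * u x * η ‖x‖) =
      ∫ x : E N, (oddPow p (w ‖x‖) * deriv η ‖x‖ -
        (μ / ‖x‖ ^ p + lam) * oddPow p (U ‖x‖) * η ‖x‖) := by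
    refine Eq.trans ?_ (setIntegral_eq_integral_of_forall_compl_eq_zero
      (s := Metric.ball (0 : E N) R) ?_)
    · refine integral_congr_ae ?_
      filter_upwards [hu, hDu, ae_restrict_of_ae hne] with x h1 h2 h3
      have hn : ‖x‖ ≠ 0 := norm_ne_zero_iff.2 h3
      have h4 : ‖Du x‖ = |w ‖x‖| := by
        rw [h2, norm_smul, norm_mul, norm_inv, norm_norm, mul_assoc, inv_mul_cancel₀ hn, mul_one,
          Real.norm_eq_abs]
      have h5 : inner ℝ (Du x) (gradient (fun x : E N => η ‖x‖) x) = w ‖x‖ * deriv η ‖x‖ := by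
        rw [gradient_radial (hη.smooth.differentiable (by simp) ‖x‖).hasDerivAt h3, h2, inner_smul_left,
          inner_smul_right, real_inner_self_eq_norm_sq, conj_trivial]
        field_simp
      rw [h4, h5, h1]
      simp only [oddPow]
      ring
    · intro x hx
      have h1 : η ‖x‖ = 0 := image_eq_zero_of_notMem_tsupport fun h' =>
        hx (by simpa using (hη.supp h').2)
      have h2 : deriv η ‖x‖ = 0 := image_eq_zero_of_notMem_tsupport fun h' =>
        hx (by simpa using (hη.deriv.supp h').2)
      rw [h1, h2]; ring
  have e2 : ∫ x in Metric.ball (0 : E N) R, |u x| ^ (pstar N p s - 2) * u x / ‖x‖ ^ s * η ‖x‖ =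
      ∫ x : E N, oddPow (pstar N p s) (U ‖x‖) / ‖x‖ ^ s * η ‖x‖ := by
    refine Eq.trans ?_ (setIntegral_eq_integral_of_forall_compl_eq_zero
      (s := Metric.ball (0 : E N) R) ?_)
    · refine integral_congr_ae ?_
      filter_upwards [hu] with x h1
      rw [h1]; rfl
    · intro x hx
      have h1 : η ‖x‖ = 0 := image_eq_zero_of_notMem_tsupport fun h' =>
        hx (by simpa using (hη.supp h').2)
      rw [h1]; ring
  rw [e1, e2, integral_radial (fun r => oddPow p (w r) * deriv η r -
    (μ / r ^ p + lam) * oddPow p (U r) * η r),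
    integral_radial (fun r => oddPow (pstar N p s) (U r) / r ^ s * η r)] at heq
  have heq' := mul_left_cancel₀ (sphereArea_pos (N := N)).ne' heq
  have hc : ∀ a, 1 < a → ContinuousOn (fun r => oddPow a (U r)) (Ioo 0 R) := fun a ha =>
    (continuous_oddPow ha).comp_continuousOn hU
  have hrp : ∀ a : ℝ, ContinuousOn (fun r : ℝ => r ^ a) (Ioo 0 R) := fun a r hr =>
    (Real.continuousAt_rpow_const r a (Or.inl hr.1.ne')).continuousWithinAt
  have hpow : ContinuousOn (fun r : ℝ => r ^ (N - 1)) (Ioo 0 R) := by fun_prop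
  have c1 : ContinuousOn (fun r => r ^ (N - 1) * ((μ / r ^ p + lam) * oddPow p (U r))) (Ioo 0 R) :=
    hpow.mul (((continuousOn_const.div (hrp p) fun r hr => (Real.rpow_pos_of_pos hr.1 p).ne').add
      continuousOn_const).mul (hc p hp))
  have c2 : ContinuousOn (fun r => r ^ (N - 1) * (oddPow (pstar N p s) (U r) / r ^ s)) (Ioo 0 R) :=
    hpow.mul ((hc _ (by linarith)).div (hrp s) fun r hr => (Real.rpow_pos_of_pos hr.1 s).ne')
  have i0 := integrable_mul_of_tsupport_subset hw hη.deriv.smooth.continuous hη.deriv.compact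
    hη.deriv.supp
  have i1 := integrable_mul_of_tsupport_subset (c1.locallyIntegrableOn (μ := volume)
    measurableSet_Ioo) hη.smooth.continuous hη.compact hη.supp
  have i2 := integrable_mul_of_tsupport_subset (c2.locallyIntegrableOn (μ := volume)
    measurableSet_Ioo) hη.smooth.continuous hη.compact hη.supp
  have l1 : ∫ r in Ioi (0 : ℝ), r ^ (N - 1) * (oddPow p (w r) * deriv η r -
      (μ / r ^ p + lam) * oddPow p (U r) * η r) =
      (∫ r, (r ^ (N - 1) * oddPow p (w r)) * deriv η r) -
      ∫ r, (r ^ (N - 1) * ((μ / r ^ p + lam) * oddPow p (U r))) * η r := by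
    rw [← integral_Ioi_eq_of_isTest1 hη.deriv, ← integral_Ioi_eq_of_isTest1 hη,
      ← integral_sub i0.integrableOn i1.integrableOn]
    congr 1
    funext r; ring
  have l2 : ∫ r in Ioi (0 : ℝ), r ^ (N - 1) * (oddPow (pstar N p s) (U r) / r ^ s * η r) =
      ∫ r, (r ^ (N - 1) * (oddPow (pstar N p s) (U r) / r ^ s)) * η r := by
    rw [← integral_Ioi_eq_of_isTest1 hη]
    congr 1
    funext r; ring
  have l3 : ∫ r, -(r ^ (N - 1) * ((μ / r ^ p + lam) * oddPow p (U r) +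
        oddPow (pstar N p s) (U r) / r ^ s)) * η r =
      -((∫ r, (r ^ (N - 1) * ((μ / r ^ p + lam) * oddPow p (U r))) * η r) +
        ∫ r, (r ^ (N - 1) * (oddPow (pstar N p s) (U r) / r ^ s)) * η r) := by
    rw [← integral_add i1 i2, ← integral_neg]
    congr 1
    funext r; ring
  rw [l1, l2] at heq'
  rw [l3]
  linarith

/-- A radial weak solution has a `C¹` representative that solves the radial equation. -/
theorem IsWeakSolution.exists_isRadialSolution (hp : 1 < p) (hpN : p < N) (hsp : s < p)
    (hR : 0 < R) (h : IsWeakSolution p μ s lam (Metric.ball 0 R) u Du)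
    (hrad : IsRadialOn (Metric.ball (0 : E N) R) u) :
    ∃ U V, IsRadialSolution N p μ s lam R U V ∧
      (∀ᵐ x ∂(volume.restrict (Metric.ball (0 : E N) R)), u x = U ‖x‖) ∧
      ∀ᵐ x ∂(volume.restrict (Metric.ball (0 : E N) R)), Du x = (V ‖x‖ * ‖x‖⁻¹) • x := by
  obtain ⟨f, hf⟩ := hrad
  obtain ⟨w, c, hw, hu, hDu⟩ := h.mem.exists_radial_primitive hR hp.le hf
  have hr : R / 2 ∈ Ioo 0 R := ⟨by linarith, by linarith⟩
  set U : ℝ → ℝ := fun r => c + ∫ t in (R / 2)..r, w t with hUdef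
  have hUc : ContinuousOn U (Ioo 0 R) := continuousOn_const.add (continuousOn_primitive_of_mem hw hr)
  have hen := integrableOn_energy hp h.mem.memLp_grad hDu
  have hfl := locallyIntegrableOn_flux hp hw hen
  set K : ℝ → ℝ := fun r => -(r ^ (N - 1) * ((μ / r ^ p + lam) * oddPow p (U r) +
    oddPow (pstar N p s) (U r) / r ^ s)) with hKdef
  have hps := lt_pstar hp hpN hsp
  have hrp : ∀ a : ℝ, ContinuousOn (fun r : ℝ => r ^ a) (Ioo 0 R) := fun a r hr =>
    (Real.continuousAt_rpow_const r a (Or.inl hr.1.ne')).continuousWithinAt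
  have hc : ∀ a, 1 < a → ContinuousOn (fun r => oddPow a (U r)) (Ioo 0 R) := fun a ha =>
    (continuous_oddPow ha).comp_continuousOn hUc
  have hpow : ContinuousOn (fun r : ℝ => r ^ (N - 1)) (Ioo 0 R) := by fun_prop
  have hK : ContinuousOn K (Ioo 0 R) :=
    (hpow.mul ((((continuousOn_const.div (hrp p) fun r hr =>
      (Real.rpow_pos_of_pos hr.1 p).ne').add continuousOn_const).mul (hc p hp)).add
      ((hc _ (by linarith)).div (hrp s) fun r hr => (Real.rpow_pos_of_pos hr.1 s).ne'))).neg
  have hKl := hK.locallyIntegrableOn (μ := volume) measurableSet_Ioo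
  -- Second use of du Bois-Reymond: the flux equals almost everywhere a primitive of the continuous
  -- function `K`, hence a C¹ function `Φ`.
  obtain ⟨c', hc'⟩ := ae_eq_primitive_of_weak_deriv hR hfl hKl
    (fun η hη => h.integral_flux_mul_deriv hp hpN hsp hu hDu hfl hUc hη) hr
  set Φ : ℝ → ℝ := fun r => c' + ∫ t in (R / 2)..r, K t
  have hprim : ∀ {g : ℝ → ℝ}, ContinuousOn g (Ioo 0 R) → ∀ b r, r ∈ Ioo 0 R →
      HasDerivAt (fun r => b + ∫ t in (R / 2)..r, g t) (g r) r :=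
    fun hg b _ hr' => HasDerivAt.const_add b (hasDerivAt_primitive_of_continuousOn hg hr hr')
  have hΦ : ∀ r ∈ Ioo 0 R, HasDerivAt Φ (K r) r := hprim hK c'
  have hΦc : ContinuousOn Φ (Ioo 0 R) := fun r hr => (hΦ r hr).continuousAt.continuousWithinAt
  have hpq := Real.HolderConjugate.conjExponent hp
  set q := p.conjExponent
  -- Undoing the odd power in the flux gives a continuous representative of w, so U is C¹.
  set V : ℝ → ℝ := fun r => oddPow q (Φ r / r ^ (N - 1))
  have hVc : ContinuousOn V (Ioo 0 R) :=
    (continuous_oddPow hpq.symm.lt).comp_continuousOn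
      (hΦc.div hpow fun r hr => pow_ne_zero _ hr.1.ne')
  have hVfl : ∀ r ∈ Ioo 0 R, r ^ (N - 1) * oddPow p (V r) = Φ r := by
    intro r hr
    have : r ^ (N - 1) ≠ 0 := pow_ne_zero _ hr.1.ne'
    simp only [V]
    rw [oddPow_conj hpq.symm]
    field_simp
  have hwV : ∀ᵐ r, r ∈ Ioo 0 R → w r = V r := by
    filter_upwards [hc'] with r h1 h2
    have : r ^ (N - 1) ≠ 0 := pow_ne_zero _ h2.1.ne'
    simp only [V, Φ]
    rw [← h1 h2, mul_div_cancel_left₀ _ this, oddPow_conj hpq]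
  have hUV : ∀ r ∈ Ioo 0 R, U r = c + ∫ t in (R / 2)..r, V t := by
    intro r hr'
    simp only [U]
    congr 1
    refine intervalIntegral.integral_congr_ae ?_
    filter_upwards [hwV] with t h1 h2
    exact h1 (ordConnected_Ioo.uIcc_subset hr hr' (uIoc_subset_uIcc h2))
  have hDu' : ∀ᵐ x ∂(volume.restrict (Metric.ball (0 : E N) R)),
      Du x = (V ‖x‖ * ‖x‖⁻¹) • x := by
    filter_upwards [hDu, ae_restrict_of_ae (ae_norm_of_ae (N := N) hwV),
      ae_restrict_mem measurableSet_ball] with x h1 h2 h3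
    rw [h1, h2 h3]
  refine ⟨U, V, ⟨fun r hr' => ?_, hVc, fun r hr' => ?_, ?_⟩, hu, hDu'⟩
  · refine (hprim hVc c r hr').congr_of_eventuallyEq ?_
    filter_upwards [isOpen_Ioo.mem_nhds hr'] with t ht using hUV t ht
  · refine (hΦ r hr').congr_of_eventuallyEq ?_
    filter_upwards [isOpen_Ioo.mem_nhds hr'] with t ht using hVfl t ht
  · exact integrableOn_energy hp h.mem.memLp_grad hDu'

end RadialEquation

/-! ### Strong maximum principle and decay from finite energy -/

section Positivity
open Set
variable {N : ℕ} {p μ s lam R : ℝ} {U V : ℝ → ℝ}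

/-- A set of full measure is dense and so meets every open annulus of the ball. -/
theorem exists_pos_mem_Ioo [Nontrivial (E N)]
    (hpos : ∀ᵐ x ∂(volume.restrict (Metric.ball (0 : E N) R)), 0 < U ‖x‖)
    {a b : ℝ} (ha : 0 ≤ a) (hab : a < b) (hb : b ≤ R) : ∃ r ∈ Ioo a b, 0 < U r := by
  rw [ae_restrict_iff' measurableSet_ball] at hpos
  have hd := Measure.dense_of_ae hpos
  have hopen : IsOpen ((fun x : E N => ‖x‖) ⁻¹' Ioo a b) := isOpen_Ioo.preimage continuous_norm
  obtain ⟨x, hx⟩ := NormedSpace.exists_lt_norm ℝ (E N) 0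
  have hne : ((fun x : E N => ‖x‖) ⁻¹' Ioo a b).Nonempty := by
    refine ⟨(((a + b) / 2) * ‖x‖⁻¹) • x, ?_⟩
    have : ‖(((a + b) / 2) * ‖x‖⁻¹) • x‖ = (a + b) / 2 := by
      rw [norm_smul, norm_mul, norm_inv, norm_norm, mul_assoc, inv_mul_cancel₀ hx.ne', mul_one,
        Real.norm_of_nonneg (by linarith)]
    simp only [mem_preimage, this]
    constructor <;> linarith
  obtain ⟨y, hy, hy'⟩ := hd.inter_open_nonempty _ hopen hne
  exact ⟨‖y‖, hy, hy' (by simpa using hy.2.trans_le hb)⟩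

theorem IsRadialSolution.continuousOn_self (h : IsRadialSolution N p μ s lam R U V) :
    ContinuousOn U (Ioo 0 R) := fun r hr => (h.hasDerivAt r hr).continuousAt.continuousWithinAt

theorem IsRadialSolution.nonneg (h : IsRadialSolution N p μ s lam R U V)
    (hpos : ∀ a b, 0 ≤ a → a < b → b ≤ R → ∃ r ∈ Ioo a b, 0 < U r) {r : ℝ} (hr : r ∈ Ioo 0 R) :
    0 ≤ U r := by
  by_contra! hneg
  have h1 := (((h.hasDerivAt r hr).continuousAt.eventually (gt_mem_nhds hneg)).and
    (isOpen_Ioo.mem_nhds hr))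
  obtain ⟨ε, hε, hball⟩ := Metric.eventually_nhds_iff_ball.1 h1
  obtain ⟨t, ht, ht'⟩ := hpos r (min (r + ε) R) hr.1.le (lt_min (by linarith) hr.2)
    (min_le_right _ _)
  have := (hball t (by
    rw [Metric.mem_ball, Real.dist_eq, abs_of_pos (by linarith [ht.1])]
    linarith [ht.2, min_le_left (r + ε) R])).1
  linarith

/-- Strong maximum principle for radial solutions. -/
theorem IsRadialSolution.pos (hp : 1 < p) (hpN : p < N) (hsp : s < p)
    (h : IsRadialSolution N p μ s lam R U V)
    (hpos : ∀ a b, 0 ≤ a → a < b → b ≤ R → ∃ r ∈ Ioo a b, 0 < U r) {r₀ : ℝ} (hr : r₀ ∈ Ioo 0 R) :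
    0 < U r₀ := by
  refine lt_of_le_of_ne (h.nonneg hpos hr) fun h0 => ?_
  have hps := lt_pstar hp hpN hsp
  -- A zero of the nonnegative U is a minimum, so the flux vanishes at r₀ as well.
  have hV0 : V r₀ = 0 := by
    refine IsLocalMin.hasDerivAt_eq_zero ?_ (h.hasDerivAt r₀ hr)
    filter_upwards [isOpen_Ioo.mem_nhds hr] with t ht
    rw [← h0]
    exact h.nonneg hpos ht
  set J := Icc (r₀ / 2) ((r₀ + R) / 2) with hJdef
  have hJ : J ⊆ Ioo 0 R := Icc_subset_Ioo (by linarith [hr.1]) (by linarith [hr.2])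
  -- With this coefficient the equation reads: derivative of the flux equals -k U^(p-1), and k is
  -- bounded near r₀.
  set k : ℝ → ℝ := fun r => r ^ (N - 1) * (μ / r ^ p + lam + U r ^ (pstar N p s - p) / r ^ s)
  have hrp : ∀ a : ℝ, ContinuousOn (fun r : ℝ => r ^ a) (Ioo 0 R) := fun a r hr =>
    (Real.continuousAt_rpow_const r a (Or.inl hr.1.ne')).continuousWithinAt
  have hk : ContinuousOn k J := by
    refine ContinuousOn.mono ?_ hJ
    refine ContinuousOn.mul (by fun_prop) (((continuousOn_const.div (hrp p) fun r hr =>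
      (Real.rpow_pos_of_pos hr.1 p).ne').add continuousOn_const).add
      ((h.continuousOn_self.rpow_const fun r _ => Or.inr (by linarith)).div (hrp s) fun r hr =>
      (Real.rpow_pos_of_pos hr.1 s).ne'))
  have hinv : ContinuousOn (fun r : ℝ => (r ^ (N - 1))⁻¹) J :=
    ContinuousOn.inv₀ (by fun_prop) fun r hr => pow_ne_zero _ (hJ hr).1.ne'
  obtain ⟨K₁, hK₁⟩ := isCompact_Icc.exists_bound_of_continuousOn hk
  obtain ⟨K₂, hK₂⟩ := isCompact_Icc.exists_bound_of_continuousOn hinv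
  have hr₀J : r₀ ∈ J := ⟨by linarith [hr.1], by linarith [hr.2]⟩
  have hK₁0 : 0 ≤ K₁ := (norm_nonneg _).trans (hK₁ r₀ hr₀J)
  have hK₂0 : 0 ≤ K₂ := (norm_nonneg _).trans (hK₂ r₀ hr₀J)
  -- Let M be the maximum of U on the ε-interval. Integrating the flux from r₀ gives |V|^(p-1) ≤ K₂
  -- K₁ ε M^(p-1), so |V| ≤ M; integrating V then gives M ≤ ε M ≤ M/2. Hence M = 0, although U is
  -- positive somewhere in every subinterval.
  obtain ⟨ε, hε0, hε1, hε2, hε3⟩ : ∃ ε > 0, ε ≤ 1 / 2 ∧ K₂ * K₁ * ε ≤ 1 ∧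
      Icc (r₀ - ε) (r₀ + ε) ⊆ J := by
    have hden : 0 < K₂ * K₁ + 1 := by positivity
    have hm : 0 < min (r₀ / 2) ((R - r₀) / 2) := lt_min (by linarith [hr.1]) (by linarith [hr.2])
    refine ⟨min (min (1 / 2) (1 / (K₂ * K₁ + 1))) (min (r₀ / 2) ((R - r₀) / 2)),
      by positivity, (min_le_left _ _).trans (min_le_left _ _), ?_, ?_⟩
    · have := (min_le_left (min (1 / 2) (1 / (K₂ * K₁ + 1)))
        (min (r₀ / 2) ((R - r₀) / 2))).trans (min_le_right _ _)
      calc _ ≤ K₂ * K₁ * (1 / (K₂ * K₁ + 1)) := mul_le_mul_of_nonneg_left this (by positivity)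
        _ ≤ 1 := by
          rw [mul_one_div, div_le_one hden]; linarith
    · have h1 := (min_le_right (min (1 / 2) (1 / (K₂ * K₁ + 1)))
        (min (r₀ / 2) ((R - r₀) / 2))).trans (min_le_left _ _)
      have h2 := (min_le_right (min (1 / 2) (1 / (K₂ * K₁ + 1)))
        (min (r₀ / 2) ((R - r₀) / 2))).trans (min_le_right _ _)
      exact Icc_subset_Icc (by linarith) (by linarith)
  set I := Icc (r₀ - ε) (r₀ + ε)
  have hr₀I : r₀ ∈ I := ⟨by linarith, by linarith⟩
  have hIR : I ⊆ Ioo 0 R := hε3.trans hJ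
  obtain ⟨rm, hrm, hmax⟩ := isCompact_Icc.exists_isMaxOn ⟨r₀, hr₀I⟩
    (h.continuousOn_self.mono hIR)
  set M := U rm
  have hM0 : 0 ≤ M := h.nonneg hpos (hIR hrm)
  have hUM : ∀ r ∈ I, U r ≤ M := fun r hr => hmax hr
  have hflux : ∀ r ∈ I, |r ^ (N - 1) * oddPow p (V r)| ≤ K₁ * M ^ (p - 1) * |r - r₀| := by
    intro r hrI
    have := (convex_Icc (r₀ - ε) (r₀ + ε)).norm_image_sub_le_of_norm_hasDerivWithin_le
      (f := fun r => r ^ (N - 1) * oddPow p (V r)) (C := K₁ * M ^ (p - 1))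
      (fun x hx => (h.flux x (hIR hx)).hasDerivWithinAt) (fun x hx => ?_) hr₀I hrI
    · simpa [hV0] using this
    · have hU0 := h.nonneg hpos (hIR hx)
      have e : -(x ^ (N - 1) * ((μ / x ^ p + lam) * oddPow p (U x) +
          oddPow (pstar N p s) (U x) / x ^ s)) = -(k x * U x ^ (p - 1)) := by
        rw [oddPow_of_nonneg hp hU0, oddPow_of_nonneg (by linarith) hU0,
          show pstar N p s - 1 = (pstar N p s - p) + (p - 1) by ring,
          Real.rpow_add_of_nonneg hU0 (by linarith) (by linarith)]
        simp only [k]; ring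
      rw [e, norm_neg, norm_mul, Real.norm_of_nonneg (Real.rpow_nonneg hU0 _)]
      exact mul_le_mul (hK₁ x (hε3 hx)) (Real.rpow_le_rpow hU0 (hUM x hx) (by linarith))
        (Real.rpow_nonneg hU0 _) hK₁0
  have hV : ∀ r ∈ I, |V r| ≤ M := by
    intro r hrI
    have hpow : 0 < r ^ (N - 1) := pow_pos (hIR hrI).1 _
    have h1 : |V r| ^ (p - 1) ≤ M ^ (p - 1) := by
      rw [← abs_oddPow hp]
      have h2 := hflux r hrI
      rw [abs_mul, abs_of_pos hpow] at h2
      have h3 := hK₂ r (hε3 hrI)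
      rw [Real.norm_of_nonneg (inv_pos.2 hpow).le] at h3
      have h4 : |r - r₀| ≤ ε := abs_le.2 ⟨by linarith [hrI.1], by linarith [hrI.2]⟩
      have h5 : 0 ≤ M ^ (p - 1) := Real.rpow_nonneg hM0 _
      calc |oddPow p (V r)| = (r ^ (N - 1))⁻¹ * (r ^ (N - 1) * |oddPow p (V r)|) := by
            field_simp
        _ ≤ K₂ * (K₁ * M ^ (p - 1) * ε) := mul_le_mul h3
            (h2.trans (mul_le_mul_of_nonneg_left h4 (by positivity))) (by positivity) hK₂0
        _ = K₂ * K₁ * ε * M ^ (p - 1) := by ring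
        _ ≤ 1 * M ^ (p - 1) := mul_le_mul_of_nonneg_right hε2 h5
        _ = _ := one_mul _
    exact (Real.rpow_le_rpow_iff (abs_nonneg _) hM0 (by linarith)).1 h1
  have hUle : U rm ≤ M * |rm - r₀| := by
    have := (convex_Icc (r₀ - ε) (r₀ + ε)).norm_image_sub_le_of_norm_hasDerivWithin_le
      (f := U) (C := M) (fun x hx => (h.hasDerivAt x (hIR hx)).hasDerivWithinAt)
      (fun x hx => hV x hx) hr₀I hrm
    rw [← h0, sub_zero] at this
    exact (le_abs_self _).trans this
  have hle : |rm - r₀| ≤ 1 / 2 := (abs_le.2 ⟨by linarith [hrm.1], by linarith [hrm.2]⟩ :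
    |rm - r₀| ≤ ε).trans hε1
  have hM : M ≤ 0 := by
    have := mul_le_mul_of_nonneg_left hle hM0
    linarith
  obtain ⟨t, ht, ht'⟩ := hpos r₀ (r₀ + ε) hr.1.le (by linarith)
    (hIR ⟨by linarith, le_rfl⟩ : r₀ + ε ∈ Ioo 0 R).2.le
  have := hUM t ⟨by linarith [ht.1], ht.2.le⟩
  linarith

theorem le_add_rpow_mul {x ε : ℝ} (hx : 0 ≤ x) (hε : 0 < ε) (hp : 1 < p) :
    x ≤ ε + ε ^ (1 - p) * x ^ p := by
  rcases le_total x ε with h | h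
  · have : 0 ≤ ε ^ (1 - p) * x ^ p := by positivity
    linarith
  · have hx0 : 0 < x := hε.trans_le h
    have h1 : x ^ (1 - p) ≤ ε ^ (1 - p) := Real.rpow_le_rpow_of_nonpos hε h (by linarith)
    have h2 : x ^ (1 - p) * x ^ p = x := by
      rw [← Real.rpow_add hx0]; simp
    have h3 := mul_le_mul_of_nonneg_right h1 (Real.rpow_nonneg hx p)
    linarith

/-- Finite energy solutions are `o(r^{-(N-p)/p})` at the origin. -/
theorem IsRadialSolution.tendsto_rpow_mul (hp : 1 < p) (hpN : p < N) (hR : 0 < R)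
    (h : IsRadialSolution N p μ s lam R U V) (hpos : ∀ r ∈ Ioo 0 R, 0 < U r) :
    Tendsto (fun r => r ^ (((N : ℝ) - p) / p) * U r) (𝓝[>] 0) (𝓝[>] 0) := by
  set δ := ((N : ℝ) - p) / p with hδ
  have hδ0 : 0 < δ := div_pos (by linarith) (by linarith)
  have hδp : δ * p = N - p := by rw [hδ]; field_simp
  have hN : 1 ≤ N := by
    have : (1 : ℝ) < N := by linarith
    exact_mod_cast this.le
  have hIoo : ∀ᶠ r in 𝓝[>] (0 : ℝ), r ∈ Ioo 0 R := Ioo_mem_nhdsGT hR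
  refine tendsto_nhdsWithin_iff.2 ⟨?_, ?_⟩
  swap
  · filter_upwards [hIoo] with r hr
    exact mul_pos (Real.rpow_pos_of_pos hr.1 _) (hpos r hr)
  set e : ℝ → ℝ := fun r => r ^ (N - 1) * |V r| ^ p
  have hec : ContinuousOn e (Ioo 0 R) := ContinuousOn.mul (by fun_prop)
    ((h.continuousOn.abs).rpow_const fun r _ => Or.inr (by linarith))
  have hen : ∀ r ∈ Ioo 0 R, 0 ≤ e r := fun r hr =>
    mul_nonneg (pow_nonneg hr.1.le _) (Real.rpow_nonneg (abs_nonneg _) _)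
  have heI : IntegrableOn e (Icc 0 (R / 2)) := by
    rw [integrableOn_Icc_iff_integrableOn_Ioo]
    exact h.energy.mono_set (Ioo_subset_Ioo le_rfl (by linarith))
  have hprim : Tendsto (fun ρ => ∫ t in (0 : ℝ)..ρ, e t) (𝓝[>] 0) (𝓝 0) := by
    have h1 := intervalIntegral.continuousOn_primitive_interval
      (by rwa [uIcc_of_le (by linarith)] : IntegrableOn e (uIcc 0 (R / 2)) volume)
    rw [uIcc_of_le (by linarith)] at h1
    have h2 := h1 0 ⟨le_rfl, by linarith⟩
    rw [ContinuousWithinAt, intervalIntegral.integral_same] at h2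
    refine h2.mono_left ?_
    rw [nhdsWithin_Icc_eq_nhdsGE (by linarith)]
    exact nhdsWithin_mono _ Ioi_subset_Ici_self
  rw [Metric.tendsto_nhds]
  intro ε hε
  -- Chosen so that the integral of ε₁ r^δ t^(-δ-1) over t ≥ r equals ε/4. Two further quarters come
  -- from the energy on (0, ρ), multiplied by `B`, and from r^δ U(ρ) for r near 0.
  set ε₁ := ε * δ / 4 with hε₁
  have hε₁0 : 0 < ε₁ := by positivity
  set B := ε₁ ^ (1 - p)
  have hB : 0 < B := Real.rpow_pos_of_pos hε₁0 _
  obtain ⟨ρ, hρ1, hρ2⟩ := ((hprim.eventually (gt_mem_nhds (show 0 < ε / 4 / B by positivity))).and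
    (Ioo_mem_nhdsGT (show 0 < R / 2 by linarith))).exists
  have hρR : ρ ∈ Ioo 0 R := ⟨hρ2.1, by linarith [hρ2.2]⟩
  rw [lt_div_iff₀ hB] at hρ1
  have hlim : Tendsto (fun r : ℝ => r ^ δ * U ρ) (𝓝[>] 0) (𝓝 0) := by
    have h1 : Tendsto (fun r : ℝ => r ^ δ * U ρ) (𝓝 0) (𝓝 ((0 : ℝ) ^ δ * U ρ)) :=
      (Real.continuousAt_rpow_const 0 δ (Or.inr hδ0.le)).tendsto.mul_const _
    rw [Real.zero_rpow hδ0.ne', zero_mul] at h1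
    exact h1.mono_left nhdsWithin_le_nhds
  filter_upwards [hlim.eventually (gt_mem_nhds (show 0 < ε / 4 by positivity)),
    Ioo_mem_nhdsGT hρ2.1] with r hr1 hr2
  have hrR : r ∈ Ioo 0 R := ⟨hr2.1, hr2.2.trans hρR.2⟩
  have hsub : Icc r ρ ⊆ Ioo 0 R := Icc_subset_Ioo hr2.1 hρR.2
  have hrδ : 0 < r ^ δ := Real.rpow_pos_of_pos hr2.1 _
  -- Monotonicity of this function on [r, ρ] bounds r^δ U(r) by r^δ U(ρ) + ε₁/δ + B ∫ e, the
  -- integral being over [r, ρ].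
  have hd : ∀ t ∈ Icc r ρ, HasDerivAt
      (fun t => r ^ δ * U t - ε₁ / δ * r ^ δ * t ^ (-δ) + B * ∫ x in r..t, e x)
      (r ^ δ * V t - ε₁ / δ * r ^ δ * (-δ * t ^ (-δ - 1)) + B * e t) t := fun t ht =>
    (((h.hasDerivAt t (hsub ht)).const_mul _).sub ((Real.hasDerivAt_rpow_const
      (Or.inl (hsub ht).1.ne')).const_mul _)).add
      ((hasDerivAt_primitive_of_continuousOn hec hrR (hsub ht)).const_mul B)
  have hmono := monotoneOn_of_hasDerivWithinAt_nonneg (convex_Icc r ρ)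
    (fun t ht => (hd t ht).continuousAt.continuousWithinAt)
    (fun t ht => (hd t (interior_subset ht)).hasDerivWithinAt) (fun t ht => by
      have ht' := interior_subset ht
      have ht0 : 0 < t := (hsub ht').1
      -- The scale-invariant slope. Splitting A ≤ ε₁ + B A^p bounds r^δ |V| by an explicit power
      -- plus B times the energy density, using r^δ ≤ t^δ and δp = N - p.
      set A := t ^ (δ + 1) * |V t|
      have hA := le_add_rpow_mul (p := p) (show 0 ≤ A by positivity) hε₁0 hp
      have hc : 0 ≤ r ^ δ * t ^ (-δ - 1) := by positivity
      have h1 := mul_le_mul_of_nonneg_left hA hc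
      have h2 : r ^ δ * t ^ (-δ - 1) * A = r ^ δ * |V t| := by
        have : t ^ (-δ - 1) * t ^ (δ + 1) = 1 := by
          rw [← Real.rpow_add ht0]; simp
        simp only [A]
        linear_combination r ^ δ * |V t| * this
      have h3 : r ^ δ * t ^ (-δ - 1) * A ^ p ≤ e t := by
        have h4 : r ^ δ ≤ t ^ δ := Real.rpow_le_rpow hr2.1.le ht'.1 hδ0.le
        have h5 : t ^ δ * t ^ (-δ - 1) * (t ^ (δ + 1)) ^ p = t ^ (N - 1) := by
          rw [← Real.rpow_mul ht0.le, ← Real.rpow_add ht0, ← Real.rpow_add ht0,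
            ← Real.rpow_natCast t (N - 1), Nat.cast_sub hN]
          congr 1
          push_cast
          linear_combination hδp
        calc r ^ δ * t ^ (-δ - 1) * A ^ p ≤ t ^ δ * t ^ (-δ - 1) * A ^ p := by gcongr
          _ = (t ^ δ * t ^ (-δ - 1) * (t ^ (δ + 1)) ^ p) * |V t| ^ p := by
              simp only [A]
              rw [Real.mul_rpow (by positivity) (abs_nonneg _)]; ring
          _ = e t := by rw [h5]
      have h6 := mul_le_mul_of_nonneg_left h3 hB.le
      have h7 : -(r ^ δ * |V t|) ≤ r ^ δ * V t := by
        have := mul_le_mul_of_nonneg_left (neg_abs_le (V t)) hrδ.le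
        linarith
      have h8 : ε₁ / δ * r ^ δ * (-δ * t ^ (-δ - 1)) = -(ε₁ * (r ^ δ * t ^ (-δ - 1))) := by
        field_simp
      rw [h8]
      rw [h2, mul_add] at h1
      linarith)
  have hm := hmono (left_mem_Icc.2 hr2.2.le) (right_mem_Icc.2 hr2.2.le) hr2.2.le
  simp only [intervalIntegral.integral_same, mul_zero, add_zero] at hm
  have h1 : r ^ δ * r ^ (-δ) = 1 := by rw [← Real.rpow_add hr2.1]; simp
  have h2 : ε₁ / δ * r ^ δ * r ^ (-δ) = ε / 4 := by
    rw [mul_assoc, h1, mul_one, hε₁]; field_simp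
  have h3 : 0 ≤ ε₁ / δ * r ^ δ * ρ ^ (-δ) := by
    have := Real.rpow_pos_of_pos hρ2.1 (-δ)
    positivity
  have h4 : ∫ x in r..ρ, e x ≤ ∫ x in (0 : ℝ)..ρ, e x := by
    rw [intervalIntegral.integral_of_le hr2.2.le, intervalIntegral.integral_of_le hρ2.1.le]
    refine setIntegral_mono_set (heI.mono_set (Ioc_subset_Icc_self.trans
      (Icc_subset_Icc le_rfl hρ2.2.le))) ?_ (Ioc_subset_Ioc_left hr2.1.le).eventuallyLE
    filter_upwards [ae_restrict_mem measurableSet_Ioc] with t ht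
    exact hen t ⟨ht.1, ht.2.trans_lt hρR.2⟩
  have h5 := mul_le_mul_of_nonneg_left h4 hB.le
  have h6 := mul_pos hrδ (hpos r hrR)
  rw [Real.dist_eq, sub_zero, abs_of_pos h6]
  linarith

end Positivity

/-! ### Passage to logarithmic variables -/

section Asymptotics
open Set
variable {N : ℕ} {p q μ s lam R : ℝ} {U V : ℝ → ℝ}

theorem oddPow_mul_of_pos {a c : ℝ} (hc : 0 < c) (x : ℝ) :
    oddPow a (c * x) = c ^ (a - 1) * oddPow a x := by
  unfold oddPow
  rw [abs_mul, abs_of_pos hc, Real.mul_rpow hc.le (abs_nonneg _),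
    show a - 1 = (a - 2) + 1 by ring, Real.rpow_add_one hc.ne']
  ring

theorem abs_rpow_eq_oddPow_mul {p : ℝ} (hp : 1 < p) (x : ℝ) : |x| ^ p = oddPow p x * x := by
  unfold oddPow
  rcases eq_or_ne x 0 with rfl | hx
  · simp [Real.zero_rpow (by linarith : p ≠ 0)]
  · have h := abs_pos.2 hx
    rw [show p = (p - 2) + 1 + 1 by ring, Real.rpow_add_one h.ne', Real.rpow_add_one h.ne',
      mul_assoc, abs_mul_abs_self]
    ring_nf

/-- The Riccati variable `-r^(p-1) |U'|^(p-2) U' / U^(p-1)`. -/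
noncomputable def riccati (N : ℕ) (p : ℝ) (U V : ℝ → ℝ) (r : ℝ) : ℝ :=
  -(r ^ (N - 1) * oddPow p (V r)) * (r ^ (p - N) * U r ^ (1 - p))

/-- The definition is in terms of the flux, whose derivative the equation supplies, whereas V is
only known to be continuous. This form shows that the variable encodes the logarithmic slope -rU'/U.
-/
theorem riccati_eq_oddPow (hpN : p < N) (hp : 1 < p) {r : ℝ} (hr : 0 < r) (hU : 0 < U r) :
    riccati N p U V r = oddPow p (-(r * V r / U r)) := by
  have hN : 1 ≤ N := by
    have : (1 : ℝ) < N := by linarith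
    exact_mod_cast this.le
  have h1 : r ^ (N - 1) * r ^ (p - N) = r ^ (p - 1) := by
    rw [← Real.rpow_natCast r (N - 1), ← Real.rpow_add hr, Nat.cast_sub hN]
    congr 1; push_cast; ring
  have h2 : U r ^ (1 - p) = (U r ^ (p - 1))⁻¹ := by
    rw [← Real.rpow_neg hU.le]; ring_nf
  have h3 : r * V r / U r = (r / U r) * V r := by ring
  rw [oddPow_neg, h3, oddPow_mul_of_pos (div_pos hr hU), Real.div_rpow hr.le hU.le, ← h1, riccati,
    h2]
  ring

/-- By the product rule, the flux contributes μ and the two perturbation terms, the factor r^(p-N)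
the linear term of the Hamiltonian, and U^(1-p) its power term. -/
theorem IsRadialSolution.hasDerivAt_riccati (hpq : p.HolderConjugate q) (hpN : p < N)
    (h : IsRadialSolution N p μ s lam R U V) (hpos : ∀ r ∈ Ioo 0 R, 0 < U r) (hps : 1 < pstar N p s)
    {r : ℝ} (hr : r ∈ Ioo 0 R) :
    HasDerivAt (riccati N p U V) ((Ham p q N μ (riccati N p U V r) +
      (r ^ (p - s) * U r ^ (pstar N p s - p) + lam * r ^ p)) / r) r := by
  have hp := hpq.lt
  have hr0 := hr.1
  have hU := hpos r hr
  have hz := riccati_eq_oddPow (V := V) hpN hp hr0 hU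
  have hd := ((h.flux r hr).neg.mul ((Real.hasDerivAt_rpow_const (x := r) (p := p - N)
    (Or.inl hr0.ne')).mul ((h.hasDerivAt r hr).rpow_const (p := 1 - p) (Or.inl hU.ne'))))
  refine hd.congr_deriv ?_
  rw [eq_div_iff hr0.ne', hz, Ham_oddPow hpq, abs_rpow_eq_oddPow_mul hp, ← hz]
  have hN : 1 ≤ N := by
    have : (1 : ℝ) < N := by linarith
    exact_mod_cast this.le
  simp only [Pi.neg_apply, Pi.mul_apply]
  set X := oddPow p (V r)
  set a := r ^ (N - 1)
  have e1 : r ^ (p - N - 1) = r ^ (p - N) / r := by rw [Real.rpow_sub_one hr0.ne']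
  have e2 : U r ^ (1 - p - 1) = U r ^ (1 - p) / U r := by rw [Real.rpow_sub_one hU.ne']
  have e3 : a * r ^ (p - N) * r = r ^ p := by
    rw [show a = r ^ ((N - 1 : ℕ) : ℝ) from (Real.rpow_natCast r (N - 1)).symm, ← Real.rpow_add hr0,
      ← Real.rpow_add_one hr0.ne', Nat.cast_sub hN]
    congr 1; push_cast; ring
  have e4 : oddPow p (U r) * U r ^ (1 - p) = 1 := by
    rw [oddPow_of_nonneg hp hU.le, ← Real.rpow_add hU]; simp
  have e5 : oddPow (pstar N p s) (U r) * U r ^ (1 - p) = U r ^ (pstar N p s - p) := by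
    rw [oddPow_of_nonneg hps hU.le, ← Real.rpow_add hU]; ring_nf
  have e6 : r ^ (p - s) = r ^ p / r ^ s := Real.rpow_sub hr0 _ _
  have e7 : riccati N p U V r = -(a * X) * (r ^ (p - N) * U r ^ (1 - p)) := rfl
  have hrp : 0 < r ^ p := Real.rpow_pos_of_pos hr0 p
  have hrs : 0 < r ^ s := Real.rpow_pos_of_pos hr0 s
  rw [e1, e2, e6, e7, ← e5]
  have t1 : a * ((μ / r ^ p + lam) * oddPow p (U r) + oddPow (pstar N p s) (U r) / r ^ s) *
      (r ^ (p - N) * U r ^ (1 - p)) * r = μ + lam * r ^ p +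
      r ^ p / r ^ s * (oddPow (pstar N p s) (U r) * U r ^ (1 - p)) := by
    calc _ = (a * r ^ (p - N) * r) * ((μ / r ^ p + lam) * (oddPow p (U r) * U r ^ (1 - p)) +
          oddPow (pstar N p s) (U r) * U r ^ (1 - p) / r ^ s) := by ring
      _ = _ := by rw [e3, e4]; field_simp
  rw [neg_neg, add_mul, t1]
  field_simp
  ring

/-- Scale invariance of the critical term: it makes r^(p-s) U^(p*-p) equal to (r^δ U)^(p*-p), so in
logarithmic variables it depends only on y - δτ. -/
theorem mul_pstar_sub (hp : 1 < p) (hpN : p < N) :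
    ((N : ℝ) - p) / p * (pstar N p s - p) = p - s := by
  have : (N : ℝ) - p ≠ 0 := by linarith
  unfold pstar
  field_simp
  ring

/-- Asymptotics at the origin of positive finite energy radial solutions. -/
theorem IsRadialSolution.asymptotics (hpq : p.HolderConjugate q) (hpN : p < N) (hsp : s < p)
    (hR : 0 < R) (h : IsRadialSolution N p μ s lam R U V) (hpos : ∀ r ∈ Ioo 0 R, 0 < U r)
    {Z₁ Z₂ : ℝ} (hZ₁ : Z₁ < oddPow p (((N : ℝ) - p) / p)) (hZ₂ : oddPow p (((N : ℝ) - p) / p) < Z₂)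
    (hH₁ : Ham p q N μ Z₁ = 0) (hH₂ : Ham p q N μ Z₂ = 0) :
    ∃ C, 0 < C ∧ Tendsto (fun r => U r * r ^ oddPow q Z₁) (𝓝[>] 0) (𝓝 C) ∧
      Tendsto (fun r => |V r| * r ^ (oddPow q Z₁ + 1)) (𝓝[>] 0) (𝓝 (|oddPow q Z₁| * C)) := by
  have hp := hpq.lt
  have hps := lt_pstar hp hpN hsp
  set δ := ((N : ℝ) - p) / p
  have hδb := mul_pstar_sub (s := s) hp hpN
  set ζ : ℝ → ℝ := fun τ => riccati N p U V (Real.exp (-τ))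
  set y : ℝ → ℝ := fun τ => Real.log (U (Real.exp (-τ)))
  -- The time is τ = -log r, so the origin is at τ = +∞; the starting time guarantees r < R.
  have hmem : ∀ τ, -Real.log R + 1 ≤ τ → Real.exp (-τ) ∈ Ioo 0 R := fun τ hτ =>
    ⟨Real.exp_pos _, by rw [← Real.lt_log_iff_exp_lt hR]; linarith⟩
  have hexp : ∀ τ, HasDerivAt (fun τ : ℝ => Real.exp (-τ)) (-Real.exp (-τ)) τ := fun τ => by
    simpa using (hasDerivAt_neg τ).exp
  have hζ : ∀ τ, -Real.log R + 1 ≤ τ → HasDerivAt ζ (-(Ham p q N μ (ζ τ) +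
      (Real.exp ((pstar N p s - p) * (y τ - δ * τ)) + lam * Real.exp (-p * τ)))) τ := by
    intro τ hτ
    have hr := hmem τ hτ
    have hU := hpos _ hr
    refine ((h.hasDerivAt_riccati hpq hpN hpos (by linarith) hr).comp τ (hexp τ)).congr_deriv ?_
    have e1 : Real.exp ((pstar N p s - p) * (y τ - δ * τ)) =
        Real.exp (-τ) ^ (p - s) * U (Real.exp (-τ)) ^ (pstar N p s - p) := by
      rw [Real.rpow_def_of_pos (Real.exp_pos _), Real.rpow_def_of_pos hU, Real.log_exp,
        ← Real.exp_add, ← hδb]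
      congr 1; simp only [y]; ring
    have e2 : Real.exp (-p * τ) = Real.exp (-τ) ^ p := by
      rw [Real.rpow_def_of_pos (Real.exp_pos _), Real.log_exp]
      congr 1; ring
    rw [e1, e2, mul_neg, div_mul_cancel₀ _ (Real.exp_pos _).ne']
  have hv : ∀ τ, -Real.log R + 1 ≤ τ →
      oddPow q (ζ τ) = -(Real.exp (-τ) * V (Real.exp (-τ)) / U (Real.exp (-τ))) := by
    intro τ hτ
    simp only [ζ]
    rw [riccati_eq_oddPow hpN hp (Real.exp_pos _) (hpos _ (hmem τ hτ)), oddPow_conj hpq]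
  have hy : ∀ τ, -Real.log R + 1 ≤ τ → HasDerivAt y (oddPow q (ζ τ)) τ := by
    intro τ hτ
    have hr := hmem τ hτ
    have hU := hpos _ hr
    refine (((h.hasDerivAt _ hr).comp τ (hexp τ)).log hU.ne').congr_deriv ?_
    rw [hv τ hτ, Function.comp_apply]; ring
  have hto0 : Tendsto (fun τ : ℝ => Real.exp (-τ)) atTop (𝓝[>] 0) :=
    tendsto_nhdsWithin_iff.2 ⟨Real.tendsto_exp_neg_atTop_nhds_zero,
      Eventually.of_forall fun τ => Real.exp_pos _⟩
  -- y - δτ is the logarithm of r^δ U, which tends to 0 from above by finite energy.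
  have hyb : Tendsto (fun τ => y τ - δ * τ) atTop atBot := by
    have h1 := Real.tendsto_log_nhdsGT_zero.comp ((h.tendsto_rpow_mul hp hpN hR hpos).comp hto0)
    refine h1.congr' ?_
    filter_upwards [eventually_ge_atTop (-Real.log R + 1)] with τ hτ
    have hU := hpos _ (hmem τ hτ)
    simp only [Function.comp_apply]
    rw [Real.log_mul (Real.rpow_pos_of_pos (Real.exp_pos _) _).ne' hU.ne',
      Real.log_rpow (Real.exp_pos _), Real.log_exp]
    simp only [y, δ]; ring
  obtain ⟨hlim, L, hL⟩ := emdenFowler_asymptotics hpq hpN (by linarith : 0 < pstar N p s - p)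
    hZ₁ hZ₂ hH₁ hH₂ hζ hy hyb
  have hlog : Tendsto (fun r => -Real.log r) (𝓝[>] 0) atTop :=
    tendsto_neg_atBot_atTop.comp Real.tendsto_log_nhdsGT_zero
  have hIoo : ∀ᶠ r in 𝓝[>] (0 : ℝ), r ∈ Ioo 0 R := Ioo_mem_nhdsGT hR
  have hT := hlog.eventually (eventually_ge_atTop (-Real.log R + 1))
  have hC : Tendsto (fun r => U r * r ^ oddPow q Z₁) (𝓝[>] 0) (𝓝 (Real.exp L)) := by
    refine ((Real.continuous_exp.tendsto L).comp (hL.comp hlog)).congr' ?_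
    filter_upwards [hIoo] with r hr
    simp only [Function.comp_apply, y, neg_neg, Real.exp_log hr.1]
    rw [Real.rpow_def_of_pos hr.1, ← Real.exp_log (hpos r hr), ← Real.exp_add, Real.log_exp]
    ring_nf
  refine ⟨Real.exp L, Real.exp_pos _, hC, ?_⟩
  have h1 : Tendsto (fun r => |oddPow q (ζ (-Real.log r))|) (𝓝[>] 0) (𝓝 |oddPow q Z₁|) :=
    (((continuous_oddPow hpq.symm.lt).tendsto _).comp (hlim.comp hlog)).abs
  -- |V| r^(γ₁+1) is the product of |rV/U| and U r^γ₁.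
  refine (h1.mul hC).congr' ?_
  filter_upwards [hIoo, hT] with r hr hr'
  have hU := hpos r hr
  rw [hv _ hr', neg_neg, Real.exp_log hr.1, abs_neg, abs_div, abs_mul, abs_of_pos hr.1,
    abs_of_pos hU, Real.rpow_add_one hr.1.ne']
  field_simp

theorem IsRadialSolution.contDiffOn (h : IsRadialSolution N p μ s lam R U V) :
    ContDiffOn ℝ 1 U (Ioo 0 R) := by
  rw [show (1 : WithTop ℕ∞) = 0 + 1 from rfl, contDiffOn_succ_iff_deriv_of_isOpen isOpen_Ioo]
  refine ⟨fun r hr => (h.hasDerivAt r hr).differentiableAt.differentiableWithinAt, by simp, ?_⟩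
  rw [contDiffOn_zero]
  exact h.continuousOn.congr fun r hr => (h.hasDerivAt r hr).deriv

theorem Gam_eq_Ham (hpq : p.HolderConjugate q) (γ : ℝ) :
    Gam N p μ γ = Ham p q N μ (oddPow p γ) := by
  rw [Ham_oddPow hpq, Gam, oddPow]
  ring

end Asymptotics
end HardyBall

/-! ### The main theorem -/

theorem theorem1p3 (N : ℕ) (p μ s lam : ℝ) (hp : 1 < p) (hpN : p < (N : ℝ))
    (hμ : μ < (((N : ℝ) - p) / p) ^ p) (hs : 0 ≤ s) (hsp : s < p) :
    ∃ γ₁ γ₂ : ℝ, γ₁ < γ₂ ∧ {γ : ℝ | HardyBall.Gam N p μ γ = 0} = {γ₁, γ₂} ∧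
      ∀ (R : ℝ), 0 < R →
      ∀ (u : HardyBall.E N → ℝ) (Du : HardyBall.E N → HardyBall.E N),
        HardyBall.IsWeakSolution p μ s lam (Metric.ball 0 R) u Du →
        HardyBall.IsPositiveOn (Metric.ball 0 R) u →
        HardyBall.IsRadialOn (Metric.ball 0 R) u →
        ∃ v : HardyBall.E N → ℝ,
          v =ᵐ[volume.restrict (Metric.ball 0 R)] u ∧
          ContDiffOn ℝ 1 v (Metric.ball 0 R \ {0}) ∧
          gradient v =ᵐ[volume.restrict (Metric.ball 0 R)] Du ∧
          ∃ C : ℝ, 0 < C ∧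
            Tendsto (fun x => v x * ‖x‖ ^ γ₁) (𝓝[≠] 0) (𝓝 C) ∧
            Tendsto (fun x => ‖gradient v x‖ * ‖x‖ ^ (γ₁ + 1)) (𝓝[≠] 0) (𝓝 (|γ₁| * C)) := by
  have hpq := Real.HolderConjugate.conjExponent hp
  set q := p.conjExponent
  obtain ⟨Z₁, Z₂, hZ₁, hZ₂, hH₁, hH₂⟩ := HardyBall.exists_Ham_zeros (μ := μ) hpq hpN hμ
  have hmono := HardyBall.oddPow_strictMono hpq.symm.lt
  refine ⟨HardyBall.oddPow q Z₁, HardyBall.oddPow q Z₂, hmono (hZ₁.trans hZ₂), ?_, ?_⟩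
  · ext γ
    simp only [Set.mem_ofPred_eq, Set.mem_insert_iff, Set.mem_singleton_iff,
      HardyBall.Gam_eq_Ham hpq]
    constructor
    · intro h
      -- On each side of the vertex the Hamiltonian is strictly monotone, so each side has a single
      -- zero.
      rcases le_total (HardyBall.oddPow p γ) (HardyBall.oddPow p (((N : ℝ) - p) / p)) with h' | h'
      · left
        rw [← (HardyBall.Ham_strictAntiOn hpq).injOn h' hZ₁.le (h.trans hH₁.symm),
          HardyBall.oddPow_conj hpq]
      · right
        rw [← (HardyBall.Ham_strictMonoOn hpq).injOn h' hZ₂.le (h.trans hH₂.symm),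
          HardyBall.oddPow_conj hpq]
    · rintro (rfl | rfl) <;> rwa [HardyBall.oddPow_conj hpq.symm]
  · intro R hR u Du hsol hpos hrad
    have hN : 0 < N := by
      have : (0 : ℝ) < N := by linarith
      exact_mod_cast this
    have : Nonempty (Fin N) := ⟨⟨0, hN⟩⟩
    have : Nontrivial (HardyBall.E N) := inferInstance
    obtain ⟨U, V, hUV, hu, hDu⟩ := hsol.exists_isRadialSolution hp hpN hsp hR hrad
    have hposU : ∀ᵐ x ∂(volume.restrict (Metric.ball (0 : HardyBall.E N) R)), 0 < U ‖x‖ := by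
      filter_upwards [hu, hpos] with x h1 h2
      rwa [← h1]
    -- The logarithm of U needs positivity at every radius, which the strong maximum principle
    -- extracts from positivity almost everywhere.
    have hU0 : ∀ r ∈ Set.Ioo 0 R, 0 < U r := fun r hr => hUV.pos hp hpN hsp
      (fun a b ha hab hb => HardyBall.exists_pos_mem_Ioo hposU ha hab hb) hr
    obtain ⟨C, hC, h1, h2⟩ := hUV.asymptotics hpq hpN hsp hR hU0 hZ₁ hZ₂ hH₁ hH₂
    have hgrad : ∀ x ∈ Metric.ball (0 : HardyBall.E N) R \ {0},
        gradient (fun x : HardyBall.E N => U ‖x‖) x = (V ‖x‖ * ‖x‖⁻¹) • x := fun x hx =>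
      HardyBall.gradient_radial (hUV.hasDerivAt _ (HardyBall.norm_mem_Ioo hx)) hx.2
    have hnorm : Tendsto (fun x : HardyBall.E N => ‖x‖) (𝓝[≠] 0) (𝓝[>] 0) :=
      tendsto_norm_nhdsNE_zero
    have hne : ∀ᵐ x : HardyBall.E N, x ≠ 0 := by simp [ae_iff]
    refine ⟨fun x => U ‖x‖, ?_, ?_, ?_, C, hC, h1.comp hnorm, ?_⟩
    · filter_upwards [hu] with x hx using hx.symm
    · exact hUV.contDiffOn.comp
        (fun x hx => (contDiffAt_norm ℝ hx.2).contDiffWithinAt) fun x hx => HardyBall.norm_mem_Ioo hx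
    · filter_upwards [hDu, ae_restrict_of_ae hne, ae_restrict_mem measurableSet_ball]
        with x hx hx0 hxR
      rw [hx, hgrad x ⟨hxR, hx0⟩]
    · refine (h2.comp hnorm).congr' ?_
      filter_upwards [self_mem_nhdsWithin,
        nhdsWithin_le_nhds (Metric.ball_mem_nhds (0 : HardyBall.E N) hR)] with x hx hxR
      have hx' : ‖x‖ ≠ 0 := norm_ne_zero_iff.2 hx
      rw [hgrad x ⟨hxR, hx⟩, norm_smul, norm_mul, norm_inv, norm_norm, mul_assoc ‖V ‖x‖‖,
        inv_mul_cancel₀ hx', mul_one]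
      rfl
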